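/- Let $m\ge 1$ be an integer and let $\mathcal W^{m,2}([0,1])$ be the space of functions $f:[0,1]\to\mathbb R$ such that $f,f',\dots,f^{(m-1)}$ exist and are absolutely continuous on $[0,1]$ and $\int_0^1 (f^{(m)})^2<\infty$. For $\lambda>0$ put $\|f\|_{m,\lambda}^2=\int_0^1 f^2+\lambda\int_0^1 (f^{(m)})^2$. For each $n\ge1$ let $t_{1n},\dots,t_{nn}\in[0,1]$ be non-random design points and let $Y_i=f_o(t_{in})+\epsilon_i$, $i=1,\dots,n$, where $f_o\in\mathcal W^{m,2}([0,1])$ and $\epsilon_1,\epsilon_2,\dots$ are independent and identically distributed real random variables. For a function $\rho:\mathbb R\to\mathbb R$, an M-type smoothing spline with smoothing parameter $\lambda_n>0$ is a minimizer over $f\in\mathcal W^{m,2}([0,1])$ of $$\frac1n\sum_{i=1}^n\rho\bigl(Y_i-f(t_{in})\bigr)+\lambda_n\int_0^1\{f^{(m)}(x)\}^2\,dx .$$ Assume: (A1) $\rho$ is convex on $\mathbb R$, and $\psi$ is any choice of subgradient of $\rho$, that is, $\rho(y)\ge\rho(x)+\psi(x)(y-x)$ for all $x,y\in\mathbb R$.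 (A2) $\lim_{t\to0}\mathbb E\{\psi(\epsilon_1+t)-\psi(\epsilon_1)\}^2=0$. (A3) $\mathbb E\{\psi(\epsilon_1)^2\}<\infty$, $\mathbb E\{\psi(\epsilon_1)\}=0$, and there is a constant $\xi>0$ with $\mathbb E\{\psi(\epsilon_1+t)\}=\xi t+o(|t|)$ as $t\to0$. (A4) The design is quasi-uniform: there is a constant $c$ such that for all $n\ge2$ and all $f\in\mathcal W^{1,2}([0,1])$, $$\Bigl|\frac1n\sum_{i=1}^n f(t_{in})-\int_0^1 f(t)\,dt\Bigr|\le\frac cn\Bigl(\int_0^1 (f')^2\Bigr)^{1/2}.$$ If $\lambda_n\to0$ and $n^m\lambda_n\to\infty$, then there exists a sequence of M-type smoothing splines $\widehat f_n$ (with $\widehat f_n$ a function of $Y_1,\dots,Y_n$) such that $$\|\widehat f_n-f_o\|_{m,\lambda_n}^2=O_P\Bigl(\lambda_n+\bigl(n\lambda_n^{1/(2m)}\bigr)^{-1}\Bigr).$$ No moment conditions on the errors $\epsilon_i$ themselves are required. -/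

import Mathlib

open MeasureTheory ProbabilityTheory Filter Topology Asymptotics Set

noncomputable section

namespace MSpline

/-- The unit interval as a set of reals. A function on `[0,1]` is represented by a function
`ℝ → ℝ`; all notions below depend only on its values on `[0,1]`. -/
abbrev I01 : Set ℝ := Icc (0 : ℝ) 1

/-- The `j`-th derivative on `[0,1]` (one-sided at the end points). -/
def D (j : ℕ) (f : ℝ → ℝ) : ℝ → ℝ := iteratedDerivWithin j f I01

/-- The Sobolev space `W^{m,2}([0,1])`: the functions whose derivatives `f^(1), …, f^(m-1)` exist on
`[0,1]`, with `f, f^(1), …, f^(m-1)` absolutely continuous and the (almost everywhere defined)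
derivative `f^(m)` square integrable. -/
def W (m : ℕ) : Set (ℝ → ℝ) :=
  {f | (∀ j, j + 1 < m → DifferentiableOn ℝ (D j f) I01) ∧
    (∀ j, j < m → AbsolutelyContinuousOnInterval (D j f) 0 1) ∧
    MemLp (D m f) 2 (volume.restrict I01)}

/-- The `L²([0,1])` inner product. -/
def inner₂ (f g : ℝ → ℝ) : ℝ := ∫ x in (0 : ℝ)..1, f x * g x

/-- The `L²([0,1])` norm. -/
def norm₂ (f : ℝ → ℝ) : ℝ := √(inner₂ f f)

/-- The inner product `⟨f, g⟩₂ + lam ⟨f^(m), g^(m)⟩₂` on `W^{m,2}([0,1])`. -/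
def innerW (m : ℕ) (lam : ℝ) (f g : ℝ → ℝ) : ℝ :=
  inner₂ f g + lam * inner₂ (D m f) (D m g)

/-- The norm associated with `innerW`. -/
def normW (m : ℕ) (lam : ℝ) (f : ℝ → ℝ) : ℝ := √(innerW m lam f f)

/-- The penalized M-type objective function, with data `(t i, y i)`. -/
def objective (ρ : ℝ → ℝ) (m : ℕ) (lam : ℝ) {n : ℕ} (t y : Fin n → ℝ) (f : ℝ → ℝ) : ℝ :=
  (1 / (n : ℝ)) * (∑ i, ρ (y i - f (t i))) + lam * ∫ x in (0 : ℝ)..1, (D m f x) ^ 2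

/-- `f` is an M-type smoothing spline: a minimizer of the objective over `W^{m,2}([0,1])`. -/
def IsMTypeSpline (ρ : ℝ → ℝ) (m : ℕ) (lam : ℝ) {n : ℕ} (t y : Fin n → ℝ) (f : ℝ → ℝ) : Prop :=
  f ∈ W m ∧ ∀ g ∈ W m, objective ρ m lam t y f ≤ objective ρ m lam t y g

/-- `ψ` is a choice of subgradient of `ρ`: `ψ x` lies in the subdifferential of `ρ` at `x`. -/
def IsSubgradient (ρ ψ : ℝ → ℝ) : Prop := ∀ x y, ρ x + ψ x * (y - x) ≤ ρ y

/-- Quasi-uniformity of the triangular array of design points `t n i`, `i = 1, …, n`. -/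
def QuasiUniform (t : (n : ℕ) → Fin n → ℝ) : Prop :=
  ∃ c : ℝ, ∀ n : ℕ, 2 ≤ n → ∀ f ∈ W 1,
    |(1 / (n : ℝ)) * (∑ i, f (t n i)) - ∫ x in (0 : ℝ)..1, f x| ≤ c / n * norm₂ (D 1 f)

/-- `X n = O_P(r n)`: for each `δ > 0` there is `M` such that `P(|X n| > M |r n|) ≤ δ` for all
large `n` (outer probability, if the event is not measurable). -/
def IsBigOP {Ω : Type*} [MeasurableSpace Ω] (P : Measure Ω) (X : ℕ → Ω → ℝ) (r : ℕ → ℝ) : Prop :=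
  ∀ δ : ℝ, 0 < δ → ∃ M : ℝ, ∀ᶠ n in atTop,
    P {ω | M * |r n| < |X n ω|} ≤ ENNReal.ofReal δ

end MSpline

end

/-!
Write `h = lam ^ (1 / (2 * m))`, `U u e = ρ (e - u) - ρ e`, and let `R²` be a large multiple of
the rate. The objective is convex, so a minimizer outside the `normW`-ball of radius `R` around
`f₀` gives `g` with `normW g = R` at which the objective at `f₀ + g` does not exceed its value at
`f₀` (`exists_on_sphere`). Expanding the objective, the curvature
`(1 / n) * ∑ i, E[U (g (t i))] + lam * ∫ (g^(m))²` is then at most a bias term of order `√lam * R`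
plus the centred process `(1 / n) * ∑ i, (E[U (g (t i))] - U (g (t i)) (ε i))`.

The curvature is at least a constant times `R²`. The Sobolev inequality at scale `h`
(`exists_sobolev_bound`), obtained from Taylor's formula and the equivalence of norms on
polynomials, shows that `|g|` is uniformly small, so that `E[U u] ≥ ξ u² / 8` applies
(`le_integral_increment`). Quasi-uniformity of the design, used for `g²`, replaces empirical
squares by `∫ g²` (`abs_empirical_sq_sub_le`); the error is of relative order `1 / (n h²)`.

The process is controlled uniformly over the ball. The loss `U` is Lipschitz in `u` near zero,
with random constant `|ψ (e - δ)| + |ψ (e + δ)|`, which is square integrable. Point evaluations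
are represented by vectors of squared norm `O(1 / h)` in the Hilbert space `L² × L²` that contains
`W m` isometrically, and symmetrization with contraction (`IsLipschitzLoss.integral_sup_le`)
bounds the expected supremum over the ball by `O(R / √(n h))`, which is small compared with `R²`.
Markov's inequality concludes (`exists_exceptional_set`). The linear term in `ψ (ε i)` needs no
separate treatment, being part of `U`; no smallness of the Lipschitz constant is needed, since the
multiple of the rate in `R²` is at disposal.

Minimizers exist (`exists_isMTypeSpline`) because `ρ` is coercive, the score taking both signs.
The penalty need not be coercive together with the data term: modulo functions vanishing at the
design points the problem is finite-dimensional (`exists_forall_penalized_le`).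
-/

namespace MSpline

/-! ### Symmetrization and contraction for Lipschitz losses -/

lemma integrable_finset_sup' {α ι : Type*} [MeasurableSpace α] {μ : Measure α} {A : Finset ι}
    (hA : A.Nonempty) {f : ι → α → ℝ} (hf : ∀ w ∈ A, Integrable (f w) μ) :
    Integrable (fun x => A.sup' hA fun w => f w x) μ := by
  have h := Finset.sup'_induction (p := fun g : α → ℝ => Integrable g μ) hA f
    (fun _ h₁ _ h₂ => h₁.sup h₂) hf
  have e : A.sup' hA f = fun x => A.sup' hA fun w => f w x :=
    funext fun x => Finset.sup'_apply hA f x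
  rwa [e] at h

/-- Contraction in one coordinate: if `v' - v` is `l`-Lipschitz as a function of `u`, then
symmetrized suprema do not decrease when `v' - v` is replaced by `l * u`. -/
lemma two_point_comparison {ι : Type*} {A : Finset ι} (hA : A.Nonempty) (p v v' u : ι → ℝ)
    {l : ℝ} (h : ∀ w ∈ A, ∀ z ∈ A, (v' w - v w) - (v' z - v z) ≤ l * |u w - u z|) :
    A.sup' hA (fun w => p w + (v' w - v w)) + A.sup' hA (fun w => p w + (v w - v' w)) ≤
      A.sup' hA (fun w => p w + l * u w) + A.sup' hA (fun w => p w - l * u w) := by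
  obtain ⟨w, hw, hw'⟩ := A.exists_mem_eq_sup' hA (fun w => p w + (v' w - v w))
  obtain ⟨z, hz, hz'⟩ := A.exists_mem_eq_sup' hA (fun w => p w + (v w - v' w))
  rw [hw', hz']
  have h1 := h w hw z hz
  have a1 := A.le_sup' (fun w => p w + l * u w) hw
  have a2 := A.le_sup' (fun w => p w + l * u w) hz
  have a3 := A.le_sup' (fun w => p w - l * u w) hw
  have a4 := A.le_sup' (fun w => p w - l * u w) hz
  rcases abs_cases (u w - u z) with ⟨h2, -⟩ | ⟨h2, -⟩ <;> rw [h2] at h1 <;> linarith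

section Contraction

variable {μ : Measure ℝ} {U : ℝ → ℝ → ℝ} {Λ : ℝ → ℝ} {δ : ℝ}

/-- A family of losses `U u e`, indexed by a parameter `u` and evaluated at an error `e`, that
vanishes at `u = 0` and is Lipschitz in `u ∈ [-δ, δ]` with a square integrable constant `Λ e`. -/
structure IsLipschitzLoss (μ : Measure ℝ) (U : ℝ → ℝ → ℝ) (Λ : ℝ → ℝ) (δ : ℝ) : Prop where
  measurable : ∀ u, Measurable (U u)
  zero : ∀ e, U 0 e = 0
  memLp : MemLp Λ 2 μ
  lipschitz : ∀ e u v, |u| ≤ δ → |v| ≤ δ → U u e - U v e ≤ Λ e * |u - v|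

lemma IsLipschitzLoss.continuousOn (h : IsLipschitzLoss μ U Λ δ) (e : ℝ) :
    ContinuousOn (fun u => U u e) {u | |u| ≤ δ} := by
  refine (LipschitzOnWith.of_dist_le_mul (K := (Λ e).toNNReal) fun u hu v hv => ?_).continuousOn
  have h1 := h.lipschitz e u v hu hv
  have h2 := h.lipschitz e v u hv hu
  rw [abs_sub_comm] at h2
  rw [Real.dist_eq, Real.dist_eq]
  refine (abs_le.2 ⟨by linarith, h1⟩ : _ ≤ Λ e * |u - v|).trans ?_
  exact mul_le_mul_of_nonneg_right (Real.le_coe_toNNReal _) (abs_nonneg _)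

/-- The centred empirical process attached to the loss `U`, with sign `expectation - sample`, for
the parameters `u i` and the errors `e i`. -/
noncomputable def deviation (μ : Measure ℝ) (U : ℝ → ℝ → ℝ) {n : ℕ} (u e : Fin n → ℝ) : ℝ :=
  ∑ i, ((∫ s, U (u i) s ∂μ) - U (u i) (e i))

lemma measurable_deviation (hU : ∀ u, Measurable (U u)) {n : ℕ} (u : Fin n → ℝ) :
    Measurable (deviation μ U u) :=
  Finset.measurable_sum _ fun i _ => measurable_const.sub ((hU _).comp (measurable_pi_apply i))

variable [IsProbabilityMeasure μ]

lemma IsLipschitzLoss.integrable (h : IsLipschitzLoss μ U Λ δ) {u : ℝ} (hu : |u| ≤ δ) :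
    Integrable (U u) μ := by
  have h0 : |(0 : ℝ)| ≤ δ := by simpa using (abs_nonneg u).trans hu
  refine ((h.memLp.integrable one_le_two).mul_const |u|).mono' (h.measurable u).aestronglyMeasurable
    (ae_of_all _ fun e => ?_)
  have h1 := h.lipschitz e u 0 hu h0
  have h2 := h.lipschitz e 0 u h0 hu
  simp only [h.zero, sub_zero, zero_sub, abs_neg] at h1 h2
  exact abs_le.2 ⟨by linarith, h1⟩

lemma IsLipschitzLoss.integrable_deviation (h : IsLipschitzLoss μ U Λ δ) {n : ℕ} {u : Fin n → ℝ}
    (hu : ∀ i, |u i| ≤ δ) :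
    Integrable (fun e => deviation μ U u e) (Measure.pi fun _ : Fin n => μ) := by
  refine integrable_finsetSum _ fun i _ => (integrable_const _).sub ?_
  exact ((measurePreserving_eval (fun _ : Fin n => μ) i).integrable_comp
    (h.measurable _).aestronglyMeasurable).2 (h.integrable (hu i))

/-- Symmetrization of a single coordinate: an independent copy of the error replaces the
expectation, and exchanging the two copies makes `two_point_comparison` applicable. -/
lemma IsLipschitzLoss.integral_sup_le_of_coordinate (h : IsLipschitzLoss μ U Λ δ) {ι : Type*}
    {A : Finset ι} (hA : A.Nonempty) (p u : ι → ℝ) (hu : ∀ w ∈ A, |u w| ≤ δ) :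
    ∫ e, A.sup' hA (fun w => p w + ((∫ s, U (u w) s ∂μ) - U (u w) e)) ∂μ ≤
      ∫ z : ℝ × ℝ, (A.sup' hA (fun w => p w + (Λ z.1 + Λ z.2) * u w) +
        A.sup' hA (fun w => p w - (Λ z.1 + Λ z.2) * u w)) / 2 ∂(μ.prod μ) := by
  have hΛ := h.memLp.integrable one_le_two
  have i1 : ∀ w ∈ A, Integrable (fun z : ℝ × ℝ => U (u w) z.1) (μ.prod μ) := fun w hw =>
    (h.integrable (hu w hw)).comp_fst μ
  have i2 : ∀ w ∈ A, Integrable (fun z : ℝ × ℝ => U (u w) z.2) (μ.prod μ) := fun w hw =>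
    (h.integrable (hu w hw)).comp_snd μ
  have I1 : Integrable (fun z : ℝ × ℝ => A.sup' hA
      (fun w => p w + (U (u w) z.2 - U (u w) z.1))) (μ.prod μ) :=
    integrable_finset_sup' hA fun w hw => (integrable_const _).add ((i2 w hw).sub (i1 w hw))
  have I2 : Integrable (fun z : ℝ × ℝ => A.sup' hA
      (fun w => p w + (U (u w) z.1 - U (u w) z.2))) (μ.prod μ) :=
    integrable_finset_sup' hA fun w hw => (integrable_const _).add ((i1 w hw).sub (i2 w hw))
  have I3 : Integrable (fun z : ℝ × ℝ => A.sup' hA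
      (fun w => p w + (Λ z.1 + Λ z.2) * u w)) (μ.prod μ) :=
    integrable_finset_sup' hA fun w _ => (integrable_const _).add
      (((hΛ.comp_fst μ).add (hΛ.comp_snd μ)).mul_const _)
  have I4 : Integrable (fun z : ℝ × ℝ => A.sup' hA
      (fun w => p w - (Λ z.1 + Λ z.2) * u w)) (μ.prod μ) :=
    integrable_finset_sup' hA fun w _ => (integrable_const _).sub
      (((hΛ.comp_fst μ).add (hΛ.comp_snd μ)).mul_const _)
  have s1 : ∫ e, A.sup' hA (fun w => p w + ((∫ s, U (u w) s ∂μ) - U (u w) e)) ∂μ ≤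
      ∫ z : ℝ × ℝ, A.sup' hA (fun w => p w + (U (u w) z.2 - U (u w) z.1)) ∂(μ.prod μ) := by
    rw [integral_prod _ I1]
    refine integral_mono_ae ?_ I1.integral_prod_left ?_
    · exact integrable_finset_sup' hA fun w hw => (integrable_const _).add
        ((integrable_const _).sub (h.integrable (hu w hw)))
    · filter_upwards [I1.prod_right_ae] with e he
      refine Finset.sup'_le hA _ fun w hw => ?_
      have i3 := h.integrable (hu w hw)
      have i4 : Integrable (fun s => U (u w) s - U (u w) e) μ := i3.sub (integrable_const _)
      calc p w + ((∫ s, U (u w) s ∂μ) - U (u w) e)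
          = ∫ s, (p w + (U (u w) s - U (u w) e)) ∂μ := by
            rw [integral_add (integrable_const _) i4,
              integral_sub i3 (integrable_const _)]
            simp
        _ ≤ _ := integral_mono ((integrable_const _).add i4) he
            fun s => A.le_sup' (fun w => p w + (U (u w) s - U (u w) e)) hw
  have s2 : ∫ z : ℝ × ℝ, A.sup' hA (fun w => p w + (U (u w) z.2 - U (u w) z.1)) ∂(μ.prod μ) =
      ∫ z : ℝ × ℝ, A.sup' hA (fun w => p w + (U (u w) z.1 - U (u w) z.2)) ∂(μ.prod μ) :=
    (integral_prod_swap (μ := μ) (ν := μ)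
      (fun z : ℝ × ℝ => A.sup' hA (fun w => p w + (U (u w) z.2 - U (u w) z.1)))).symm
  have s3 : ∫ z : ℝ × ℝ, (A.sup' hA (fun w => p w + (U (u w) z.2 - U (u w) z.1)) +
      A.sup' hA (fun w => p w + (U (u w) z.1 - U (u w) z.2))) / 2 ∂(μ.prod μ) ≤
      ∫ z : ℝ × ℝ, (A.sup' hA (fun w => p w + (Λ z.1 + Λ z.2) * u w) +
        A.sup' hA (fun w => p w - (Λ z.1 + Λ z.2) * u w)) / 2 ∂(μ.prod μ) := by
    refine integral_mono ((I1.add I2).div_const 2) ((I3.add I4).div_const 2) fun z => ?_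
    refine div_le_div_of_nonneg_right (two_point_comparison hA p _ _ u fun w hw y hy => ?_)
      zero_le_two
    have e1 := h.lipschitz z.2 (u w) (u y) (hu w hw) (hu y hy)
    have e2 := h.lipschitz z.1 (u y) (u w) (hu y hy) (hu w hw)
    rw [abs_sub_comm] at e2
    linarith
  rw [integral_div, integral_add I1 I2, ← s2, add_self_div_two] at s3
  exact s1.trans s3

/-- Symmetrization and contraction, one coordinate at a time. Each coordinate that is integrated
out turns the linear part `⟪x, w⟫` into `⟪x ± (Λ + Λ') • a i, w⟫`, and by the parallelogram law
the average of the squared norms grows by at most `K (Λ + Λ')²`. The bound on the supremum is kept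
in the form `τ / 2 * ‖x‖ ^ 2 + B ^ 2 / (2 * τ)` rather than `B * ‖x‖` because it is then quadratic
in `x`, so that these averages can be taken exactly; `τ` is optimized at the end. -/
theorem IsLipschitzLoss.integral_sup_le (h : IsLipschitzLoss μ U Λ δ)
    {H : Type*} [NormedAddCommGroup H] [InnerProductSpace ℝ H] {A : Finset H} (hA : A.Nonempty)
    {B K τ : ℝ} (hτ : 0 < τ) (hB : ∀ w ∈ A, ‖w‖ ≤ B) :
    ∀ {n : ℕ} (a : Fin n → H) (_ : ∀ i, ‖a i‖ ^ 2 ≤ K)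
      (_ : ∀ w ∈ A, ∀ i, |inner ℝ (a i) w| ≤ δ) (x : H),
      ∫ e, A.sup' hA (fun w => inner ℝ x w + deviation μ U (fun i => inner ℝ (a i) w) e)
        ∂(Measure.pi fun _ : Fin n => μ) ≤
      τ / 2 * (‖x‖ ^ 2 + n * (4 * K * ∫ e, Λ e ^ 2 ∂μ)) + B ^ 2 / (2 * τ)
  | 0, a, hK, hδ, x => by
    simp only [deviation, Finset.univ_eq_empty, Finset.sum_empty, add_zero, integral_const,
      probReal_univ, smul_eq_mul, one_mul, Nat.cast_zero, zero_mul]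
    refine Finset.sup'_le hA _ fun w hw => (real_inner_le_norm x w).trans ?_
    have h1 : ‖x‖ * ‖w‖ ≤ ‖x‖ * B := mul_le_mul_of_nonneg_left (hB w hw) (norm_nonneg _)
    have h2 : τ / 2 * ‖x‖ ^ 2 + B ^ 2 / (2 * τ) - ‖x‖ * B = (τ * ‖x‖ - B) ^ 2 / (2 * τ) := by
      field_simp
      ring
    have h3 : 0 ≤ (τ * ‖x‖ - B) ^ 2 / (2 * τ) := by positivity
    linarith
  | n + 1, a, hK, hδ, x => by
    have hΛ := h.memLp.integrable one_le_two
    have hΛ2 := h.memLp.integrable_sq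
    set ν : Measure (Fin n → ℝ) := Measure.pi fun _ : Fin n => μ with hν
    set q : H → (Fin n → ℝ) → ℝ := fun w e =>
      inner ℝ x w + deviation μ U (fun i => inner ℝ (a i.succ) w) e with hq
    set u : H → ℝ := fun w => inner ℝ (a 0) w with hu
    have iq : ∀ w ∈ A, Integrable (q w) ν := fun w hw =>
      (integrable_const _).add (h.integrable_deviation fun i => hδ w hw _)
    have iU : ∀ w ∈ A, Integrable (U (u w)) μ := fun w hw => h.integrable (hδ w hw 0)
    set G : ℝ → (Fin n → ℝ) → ℝ := fun s e =>
      A.sup' hA (fun w => q w e + ((∫ s, U (u w) s ∂μ) - U (u w) s)) with hG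
    have IG : Integrable (fun z : ℝ × (Fin n → ℝ) => G z.1 z.2) (μ.prod ν) :=
      integrable_finset_sup' hA fun w hw => ((iq w hw).comp_snd μ).add
        ((integrable_const _).sub ((iU w hw).comp_fst ν))
    set Q : (ℝ × ℝ) → (Fin n → ℝ) → ℝ := fun z e =>
      (A.sup' hA (fun w => q w e + (Λ z.1 + Λ z.2) * u w) +
        A.sup' hA (fun w => q w e - (Λ z.1 + Λ z.2) * u w)) / 2 with hQ
    have iΛ : ∀ w, Integrable (fun z : ℝ × ℝ => (Λ z.1 + Λ z.2) * u w) (μ.prod μ) := fun w =>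
      ((hΛ.comp_fst μ).add (hΛ.comp_snd μ)).mul_const _
    have I1 : Integrable (fun z : (ℝ × ℝ) × (Fin n → ℝ) =>
        A.sup' hA (fun w => q w z.2 + (Λ z.1.1 + Λ z.1.2) * u w)) ((μ.prod μ).prod ν) :=
      integrable_finset_sup' hA fun w hw => ((iq w hw).comp_snd _).add ((iΛ w).comp_fst ν)
    have I2 : Integrable (fun z : (ℝ × ℝ) × (Fin n → ℝ) =>
        A.sup' hA (fun w => q w z.2 - (Λ z.1.1 + Λ z.1.2) * u w)) ((μ.prod μ).prod ν) :=
      integrable_finset_sup' hA fun w hw => ((iq w hw).comp_snd _).sub ((iΛ w).comp_fst ν)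
    have IQ : Integrable (fun z : (ℝ × ℝ) × (Fin n → ℝ) => Q z.1 z.2) ((μ.prod μ).prod ν) :=
      (I1.add I2).div_const 2
    have s0 : ∫ e, A.sup' hA (fun w => inner ℝ x w + deviation μ U (fun i => inner ℝ (a i) w) e)
        ∂(Measure.pi fun _ : Fin (n + 1) => μ) = ∫ z : ℝ × (Fin n → ℝ), G z.1 z.2 ∂(μ.prod ν) := by
      rw [← ((measurePreserving_piFinSuccAbove (fun _ : Fin (n + 1) => μ) 0).symm).integral_comp']
      refine integral_congr_ae (ae_of_all _ fun z => ?_)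
      refine Finset.sup'_congr hA rfl fun w _ => ?_
      simp only [MeasurableEquiv.piFinSuccAbove_symm_apply, Fin.insertNthEquiv, deviation,
        Fin.sum_univ_succ, Fin.insertNth_zero, Equiv.coe_fn_mk, Fin.cons_succ, Fin.cons_zero,
        hq, hu]
      simp only [cast_eq]
      ring
    have s1 : ∫ z : ℝ × (Fin n → ℝ), G z.1 z.2 ∂(μ.prod ν) ≤
        ∫ z : (ℝ × ℝ) × (Fin n → ℝ), Q z.1 z.2 ∂((μ.prod μ).prod ν) := by
      rw [integral_prod_symm _ IG, integral_prod_symm _ IQ]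
      exact integral_mono IG.integral_prod_right IQ.integral_prod_right fun e =>
        h.integral_sup_le_of_coordinate hA (fun w => q w e) u fun w hw => hδ w hw 0
    have iS : Integrable (fun z : ℝ × ℝ => 2 * Λ z.1 ^ 2 + 2 * Λ z.2 ^ 2) (μ.prod μ) :=
      ((hΛ2.comp_fst μ).const_mul 2).add ((hΛ2.comp_snd μ).const_mul 2)
    have s2 : ∫ z : (ℝ × ℝ) × (Fin n → ℝ), Q z.1 z.2 ∂((μ.prod μ).prod ν) ≤
        ∫ z : ℝ × ℝ, (τ / 2 * (‖x‖ ^ 2 + n * (4 * K * ∫ e, Λ e ^ 2 ∂μ)) + B ^ 2 / (2 * τ) +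
          τ / 2 * K * (2 * Λ z.1 ^ 2 + 2 * Λ z.2 ^ 2)) ∂(μ.prod μ) := by
      rw [integral_prod _ IQ]
      refine integral_mono_ae IQ.integral_prod_left
        ((integrable_const _).add (iS.const_mul _)) ?_
      filter_upwards [I1.prod_right_ae, I2.prod_right_ae] with z z1 z2
      have ih1 := h.integral_sup_le hA hτ hB (fun i => a i.succ) (fun i => hK _)
        (fun w hw i => hδ w hw _) (x + (Λ z.1 + Λ z.2) • a 0)
      have ih2 := h.integral_sup_le hA hτ hB (fun i => a i.succ) (fun i => hK _)
        (fun w hw i => hδ w hw _) (x - (Λ z.1 + Λ z.2) • a 0)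
      have c1 : ∀ e, A.sup' hA (fun w => inner ℝ (x + (Λ z.1 + Λ z.2) • a 0) w +
          deviation μ U (fun i => inner ℝ (a i.succ) w) e) =
          A.sup' hA (fun w => q w e + (Λ z.1 + Λ z.2) * u w) := fun e =>
        Finset.sup'_congr hA rfl fun w _ => by
          simp only [inner_add_left, inner_smul_left, hq, hu, RCLike.conj_to_real]
          ring
      have c2 : ∀ e, A.sup' hA (fun w => inner ℝ (x - (Λ z.1 + Λ z.2) • a 0) w +
          deviation μ U (fun i => inner ℝ (a i.succ) w) e) =
          A.sup' hA (fun w => q w e - (Λ z.1 + Λ z.2) * u w) := fun e =>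
        Finset.sup'_congr hA rfl fun w _ => by
          simp only [inner_sub_left, inner_smul_left, hq, hu, RCLike.conj_to_real]
          ring
      simp only [c1] at ih1
      simp only [c2] at ih2
      -- the two signs are averaged by the parallelogram law
      have par : ‖x + (Λ z.1 + Λ z.2) • a 0‖ ^ 2 + ‖x - (Λ z.1 + Λ z.2) • a 0‖ ^ 2 ≤
          2 * (‖x‖ ^ 2 + (2 * Λ z.1 ^ 2 + 2 * Λ z.2 ^ 2) * K) := by
        have p1 := parallelogram_law_with_norm ℝ x ((Λ z.1 + Λ z.2) • a 0)
        have p2 : ‖(Λ z.1 + Λ z.2) • a 0‖ ^ 2 ≤ (2 * Λ z.1 ^ 2 + 2 * Λ z.2 ^ 2) * K := by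
          rw [norm_smul, mul_pow, Real.norm_eq_abs, sq_abs]
          exact mul_le_mul (by nlinarith [sq_nonneg (Λ z.1 - Λ z.2)]) (hK 0) (by positivity)
            (by positivity)
        nlinarith
      have s : ∫ e, Q z e ∂ν = ((∫ e, A.sup' hA (fun w => q w e + (Λ z.1 + Λ z.2) * u w) ∂ν) +
          ∫ e, A.sup' hA (fun w => q w e - (Λ z.1 + Λ z.2) * u w) ∂ν) / 2 := by
        rw [← integral_add z1 z2, ← integral_div]
      rw [s]
      have := mul_le_mul_of_nonneg_left par (half_pos hτ).le
      linarith
    rw [s0]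
    refine (s1.trans s2).trans (le_of_eq ?_)
    rw [integral_add (integrable_const _) (iS.const_mul _), integral_const_mul,
      integral_add ((hΛ2.comp_fst μ).const_mul 2) ((hΛ2.comp_snd μ).const_mul 2),
      integral_const_mul, integral_const_mul, integral_fun_fst (fun e => Λ e ^ 2),
      integral_fun_snd (fun e => Λ e ^ 2)]
    simp
    ring

lemma IsLipschitzLoss.continuousOn_integral (h : IsLipschitzLoss μ U Λ δ) :
    ContinuousOn (fun u => ∫ e, U u e ∂μ) {u | |u| ≤ δ} := by
  have key : ∀ u v, |u| ≤ δ → |v| ≤ δ →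
      (∫ e, U u e ∂μ) - ∫ e, U v e ∂μ ≤ (∫ e, Λ e ∂μ) * |u - v| := fun u v hu hv => by
    rw [← integral_sub (h.integrable hu) (h.integrable hv), ← integral_mul_const]
    exact integral_mono ((h.integrable hu).sub (h.integrable hv))
      ((h.memLp.integrable one_le_two).mul_const _) fun e => h.lipschitz e u v hu hv
  refine (LipschitzOnWith.of_dist_le_mul (K := (∫ e, Λ e ∂μ).toNNReal)
    fun u hu v hv => ?_).continuousOn
  have h1 := key u v hu hv
  have h2 := key v u hv hu
  rw [abs_sub_comm] at h2
  rw [Real.dist_eq, Real.dist_eq]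
  refine (abs_le.2 ⟨by linarith, h1⟩ : _ ≤ (∫ e, Λ e ∂μ) * |u - v|).trans ?_
  exact mul_le_mul_of_nonneg_right (Real.le_coe_toNNReal _) (abs_nonneg _)

lemma IsLipschitzLoss.continuousOn_deviation (h : IsLipschitzLoss μ U Λ δ) {n : ℕ}
    (e : Fin n → ℝ) :
    ContinuousOn (fun u : Fin n → ℝ => deviation μ U u e) {u | ∀ i, |u i| ≤ δ} :=
  have hm : ∀ i, MapsTo (fun u : Fin n → ℝ => u i) {u | ∀ i, |u i| ≤ δ} {u | |u| ≤ δ} :=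
    fun i _ hu => hu i
  continuousOn_finsetSum _ fun i _ =>
    (h.continuousOn_integral.comp (continuous_apply i).continuousOn (hm i)).sub
      ((h.continuousOn (e i)).comp (continuous_apply i).continuousOn (hm i))

/-- The set of exceptional samples is contained in a measurable one of small probability, so that
the bound is available for an uncountable index set `S`. -/
theorem IsLipschitzLoss.exists_measurableSet (h : IsLipschitzLoss μ U Λ δ)
    {H : Type*} [NormedAddCommGroup H] [InnerProductSpace ℝ H] {S : Set H} (h0 : 0 ∈ S)
    {B K τ x : ℝ} (hτ : 0 < τ) (hx : 0 < x) (hB : ∀ w ∈ S, ‖w‖ ≤ B) {n : ℕ} (a : Fin n → H)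
    (hK : ∀ i, ‖a i‖ ^ 2 ≤ K) (hδ : ∀ w ∈ S, ∀ i, |inner ℝ (a i) w| ≤ δ) :
    ∃ E : Set (Fin n → ℝ), MeasurableSet E ∧
      (∀ e, ∀ w ∈ S, x < deviation μ U (fun i => inner ℝ (a i) w) e → e ∈ E) ∧
      (Measure.pi fun _ : Fin n => μ) E ≤ ENNReal.ofReal
        ((τ / 2 * (n * (4 * K * ∫ e, Λ e ^ 2 ∂μ)) + B ^ 2 / (2 * τ)) / x) := by
  classical
  set ν : Measure (Fin n → ℝ) := Measure.pi fun _ : Fin n => μ with hν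
  set φ : H → (Fin n → ℝ) := fun w i => inner ℝ (a i) w with hφ
  -- only the values `⟪a i, w⟫` matter, and these form a separable subset of `Fin n → ℝ`
  obtain ⟨C, hCS, hCc, hC⟩ : ∃ C ⊆ S, C.Countable ∧ φ '' S ⊆ closure (φ '' C) := by
    obtain ⟨t, htS, htc, ht⟩ :=
      (TopologicalSpace.IsSeparable.of_separableSpace (φ '' S)).exists_countable_dense_subset
    obtain ⟨C, hC1, hC2, hC3⟩ := SurjOn.exists_subset_injOn_image_eq (f := φ) (s := S) htS
    exact ⟨C, hC1, countable_of_injective_of_countable_image hC2 (hC3 ▸ htc), hC3.symm ▸ ht⟩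
  obtain ⟨f, hf⟩ := (hCc.insert 0).exists_eq_range (insert_nonempty _ _)
  have hfS : ∀ k, f k ∈ S := fun k => by
    have : f k ∈ insert 0 C := hf ▸ mem_range_self k
    exact this.elim (fun h => h ▸ h0) fun h => hCS h
  set E : ℕ → Set (Fin n → ℝ) := fun N => {e | ∃ k ≤ N, x < deviation μ U (φ (f k)) e} with hE
  have mE : ∀ N, MeasurableSet (E N) := fun N => by
    have : E N = ⋃ k ∈ Iic N, {e | x < deviation μ U (φ (f k)) e} := by
      ext e; simp [hE]
    rw [this]
    exact .biUnion (to_countable _) fun k _ =>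
      measurableSet_lt measurable_const (measurable_deviation h.measurable _)
  have bE : ∀ N, ν (E N) ≤ ENNReal.ofReal
      ((τ / 2 * (n * (4 * K * ∫ e, Λ e ^ 2 ∂μ)) + B ^ 2 / (2 * τ)) / x) := fun N => by
    set A : Finset H := insert 0 ((Finset.range (N + 1)).image f) with hA
    have hAS : ∀ w ∈ A, w ∈ S := fun w hw => by
      rcases Finset.mem_insert.1 hw with rfl | hw
      · exact h0
      · obtain ⟨k, -, rfl⟩ := Finset.mem_image.1 hw
        exact hfS k
    have hne : A.Nonempty := Finset.insert_nonempty _ _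
    have main := h.integral_sup_le hne hτ (fun w hw => hB w (hAS w hw)) a hK
      (fun w hw => hδ w (hAS w hw)) 0
    simp only [inner_zero_left, zero_add, norm_zero, ne_eq, OfNat.ofNat_ne_zero,
      not_false_eq_true, zero_pow] at main
    have hdev0 : ∀ e, deviation μ U (φ 0) e = 0 := fun e => by
      have : U 0 = fun _ => 0 := funext h.zero
      simp [deviation, hφ, this]
    have hI : Integrable (fun e => A.sup' hne fun w => deviation μ U (φ w) e) ν :=
      integrable_finset_sup' hne fun w hw => h.integrable_deviation fun i => hδ w (hAS w hw) i
    have markov := mul_meas_ge_le_integral_of_nonneg (ae_of_all _ fun e =>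
      (hdev0 e).symm.le.trans (A.le_sup' (fun w => deviation μ U (φ w) e)
        (Finset.mem_insert_self _ _))) hI x
    have hsub : E N ⊆ {e | x ≤ A.sup' hne fun w => deviation μ U (φ w) e} := by
      rintro e ⟨k, hk, hke⟩
      exact hke.le.trans (A.le_sup' (fun w => deviation μ U (φ w) e) (Finset.mem_insert_of_mem
        (Finset.mem_image_of_mem f (Finset.mem_range.2 (Nat.lt_succ_of_le hk)))))
    refine (measure_mono hsub).trans ?_
    rw [← ofReal_measureReal]
    refine ENNReal.ofReal_le_ofReal ((le_div_iff₀ hx).2 ?_)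
    rw [mul_comm]
    exact markov.trans main
  refine ⟨⋃ N, E N, .iUnion mE, fun e w hw hxe => ?_, ?_⟩
  · have hcont := h.continuousOn_deviation e (φ w) (hδ w hw)
    have hev := hcont.eventually (lt_mem_nhds hxe)
    have hcl : φ w ∈ closure (φ '' C) := hC (mem_image_of_mem φ hw)
    have hCbox : φ '' C ⊆ {u | ∀ i, |u i| ≤ δ} := by
      rintro _ ⟨z, hz, rfl⟩
      exact hδ z (hCS hz)
    have : (𝓝[φ '' C] φ w).NeBot := mem_closure_iff_nhdsWithin_neBot.1 hcl
    obtain ⟨_, hu, ⟨z, hz, rfl⟩⟩ := ((hev.filter_mono (nhdsWithin_mono _ hCbox)).and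
      self_mem_nhdsWithin).exists
    obtain ⟨k, rfl⟩ : z ∈ range f := hf ▸ mem_insert_of_mem 0 hz
    exact mem_iUnion.2 ⟨k, k, le_rfl, hu⟩
  · have hmono : Monotone E := by
      rintro N N' hNN' e ⟨k, hk, he⟩
      exact ⟨k, hk.trans hNN', he⟩
    rw [hmono.measure_iUnion]
    exact iSup_le bE

end Contraction

/-! ### The Sobolev space as a linear space -/

lemma uIcc_zero_one : uIcc (0 : ℝ) 1 = I01 := uIcc_of_le zero_le_one

lemma uniqueDiffOn_I01 : UniqueDiffOn ℝ I01 := uniqueDiffOn_Icc zero_lt_one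

lemma uIcc_subset_I01 {a b : ℝ} (ha : a ∈ I01) (hb : b ∈ I01) : uIcc a b ⊆ I01 :=
  ordConnected_Icc.uIcc_subset ha hb

lemma uIoc_subset_I01 {a b : ℝ} (ha : a ∈ I01) (hb : b ∈ I01) : uIoc a b ⊆ I01 :=
  uIoc_subset_uIcc.trans (uIcc_subset_I01 ha hb)

lemma D_zero (f : ℝ → ℝ) : D 0 f = f := iteratedDerivWithin_zero

lemma D_succ (j : ℕ) (f : ℝ → ℝ) (x : ℝ) : D (j + 1) f x = derivWithin (D j f) I01 x :=
  congrFun iteratedDerivWithin_succ x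

lemma D_add_eq (i j : ℕ) (f : ℝ → ℝ) : D (i + j) f = D i (D j f) := by
  induction i with
  | zero => rw [zero_add, D_zero]
  | succ i ih =>
    ext x
    rw [Nat.succ_add, D_succ, D_succ, ih]

lemma _root_.AbsolutelyContinuousOnInterval.congr {f g : ℝ → ℝ} {a b : ℝ}
    (hf : AbsolutelyContinuousOnInterval f a b) (h : EqOn f g (uIcc a b)) :
    AbsolutelyContinuousOnInterval g a b := by
  rw [absolutelyContinuousOnInterval_iff] at hf ⊢
  intro ε hε
  obtain ⟨η, hη, H⟩ := hf ε hε
  refine ⟨η, hη, fun E hE hs => ?_⟩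
  have := H E hE hs
  rwa [Finset.sum_congr rfl fun i hi => by
    rw [h (hE.1 i hi).1, h (hE.1 i hi).2]] at this

section Basic

variable {m : ℕ} {f g : ℝ → ℝ}

lemma W.absolutelyContinuous (hf : f ∈ W m) {j : ℕ} (hj : j < m) :
    AbsolutelyContinuousOnInterval (D j f) 0 1 := hf.2.1 j hj

lemma W.continuousOn (hf : f ∈ W m) {j : ℕ} (hj : j < m) : ContinuousOn (D j f) I01 :=
  uIcc_zero_one ▸ (W.absolutelyContinuous hf hj).continuousOn

lemma W.memLp_top (hf : f ∈ W m) : MemLp (D m f) 2 (volume.restrict I01) := hf.2.2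

lemma _root_.ContinuousOn.memLp_two {f : ℝ → ℝ} (hf : ContinuousOn f I01) :
    MemLp f 2 (volume.restrict I01) := by
  obtain ⟨C, hC⟩ := isCompact_Icc.exists_bound_of_continuousOn hf
  exact MemLp.of_bound (hf.aestronglyMeasurable measurableSet_Icc) C
    ((ae_restrict_iff' measurableSet_Icc).2 (ae_of_all _ hC))

lemma W.memLp (hf : f ∈ W m) {j : ℕ} (hj : j ≤ m) : MemLp (D j f) 2 (volume.restrict I01) := by
  rcases hj.eq_or_lt with rfl | hj
  · exact W.memLp_top hf
  · exact (W.continuousOn hf hj).memLp_two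

lemma W.memLp_self (hf : f ∈ W m) : MemLp f 2 (volume.restrict I01) :=
  D_zero f ▸ W.memLp hf (Nat.zero_le m)

lemma _root_.AbsolutelyContinuousOnInterval.ae_hasDerivAt {f : ℝ → ℝ}
    (hf : AbsolutelyContinuousOnInterval f 0 1) :
    ∀ᵐ x ∂(volume.restrict I01), HasDerivAt f (derivWithin f I01 x) x := by
  rw [ae_restrict_iff' measurableSet_Icc]
  filter_upwards [hf.ae_differentiableAt] with x hx hxI
  have h := hx (uIcc_zero_one ▸ hxI)
  rw [h.derivWithin (uniqueDiffOn_I01 x hxI)]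
  exact h.hasDerivAt

lemma W.ae_hasDerivAt (hf : f ∈ W m) {j : ℕ} (hj : j < m) :
    ∀ᵐ x ∂(volume.restrict I01), HasDerivAt (D j f) (D (j + 1) f x) x := by
  filter_upwards [(W.absolutelyContinuous hf hj).ae_hasDerivAt] with x hx
  rwa [D_succ]

lemma W.integral_eq_sub (hf : f ∈ W m) {j : ℕ} (hj : j < m) {x y : ℝ} (hx : x ∈ I01)
    (hy : y ∈ I01) : ∫ s in x..y, D (j + 1) f s = D j f y - D j f x := by
  rw [← ((W.absolutelyContinuous hf hj).mono
    (uIcc_zero_one ▸ uIcc_subset_I01 hx hy)).integral_deriv_eq_sub]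
  refine intervalIntegral.integral_congr_ae ?_
  have := (ae_restrict_iff' measurableSet_Icc).1 (W.ae_hasDerivAt hf hj)
  filter_upwards [this] with s hs hxy
  exact (hs (uIoc_subset_I01 hx hy hxy)).deriv.symm

/-- Pointwise linearity of the derivatives of order less than `m`. -/
lemma W.D_linear (hf : f ∈ W m) (hg : g ∈ W m) (a b : ℝ) {j : ℕ} (hj : j < m) :
    EqOn (D j (fun x => a * f x + b * g x)) (fun x => a * D j f x + b * D j g x) I01 := by
  induction j with
  | zero => simp only [D_zero]; exact fun _ _ => rfl
  | succ j ih =>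
    intro x hx
    have hf' := hf.1 j hj x hx
    have hg' := hg.1 j hj x hx
    simp only
    rw [D_succ, derivWithin_congr (ih (by lia)) (ih (by lia) hx), D_succ, D_succ,
      derivWithin_fun_add (hf'.const_mul a) (hg'.const_mul b), derivWithin_const_mul_field,
      derivWithin_const_mul_field]

/-- Linearity of the top derivative, which exists only almost everywhere. -/
lemma W.D_linear_ae (hm : 1 ≤ m) (hf : f ∈ W m) (hg : g ∈ W m) (a b : ℝ) :
    D m (fun x => a * f x + b * g x) =ᵐ[volume.restrict I01]
      fun x => a * D m f x + b * D m g x := by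
  obtain ⟨k, rfl⟩ := Nat.exists_eq_add_of_le' hm
  filter_upwards [W.ae_hasDerivAt hf k.lt_succ_self, W.ae_hasDerivAt hg k.lt_succ_self,
    ae_restrict_mem measurableSet_Icc] with x hxf hxg hx
  have hlin := W.D_linear hf hg a b k.lt_succ_self
  rw [D_succ, derivWithin_congr hlin (hlin hx)]
  exact ((hxf.const_mul a).add (hxg.const_mul b)).hasDerivWithinAt.derivWithin
    (uniqueDiffOn_I01 x hx)

lemma W.linear_mem (hm : 1 ≤ m) (hf : f ∈ W m) (hg : g ∈ W m) (a b : ℝ) :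
    (fun x => a * f x + b * g x) ∈ W m := by
  refine ⟨fun j hj => ?_, fun j hj => ?_, ?_⟩
  · exact (((hf.1 j hj).const_mul a).add ((hg.1 j hj).const_mul b)).congr
      (W.D_linear hf hg a b (by lia))
  · exact AbsolutelyContinuousOnInterval.congr
      (((hf.2.1 j hj).const_mul a).fun_add ((hg.2.1 j hj).const_mul b))
      (uIcc_zero_one ▸ (W.D_linear hf hg a b hj).symm)
  · exact (memLp_congr_ae (W.D_linear_ae hm hf hg a b)).2
      (((W.memLp_top hf).const_mul a).add ((W.memLp_top hg).const_mul b))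

lemma D_zero_fun (j : ℕ) : D j (0 : ℝ → ℝ) = 0 := by
  induction j with
  | zero => exact D_zero 0
  | succ j ih =>
    ext x
    rw [D_succ, ih]
    exact congrFun (derivWithin_const _ (0 : ℝ)) x

lemma W.zero_mem (m : ℕ) : (0 : ℝ → ℝ) ∈ W m := by
  refine ⟨fun j _ => ?_, fun j _ => ?_, ?_⟩
  · rw [D_zero_fun]; exact differentiableOn_const 0
  · rw [D_zero_fun]
    exact (LipschitzWith.const (0 : ℝ)).lipschitzOnWith.absolutelyContinuousOnInterval
  · rw [D_zero_fun]; exact MemLp.zero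

/-- `W m` as a linear subspace of the space of all functions. -/
def sobolev (m : ℕ) (hm : 1 ≤ m) : Submodule ℝ (ℝ → ℝ) where
  carrier := W m
  zero_mem' := W.zero_mem m
  add_mem' {f g} hf hg := by
    have := W.linear_mem hm hf hg 1 1
    simp only [one_mul] at this
    exact this
  smul_mem' c f hf := by
    have := W.linear_mem hm hf hf c 0
    simp only [zero_mul, add_zero] at this
    exact this

/-- The top derivative `f ↦ f^(m)` as a linear map into `L²`. -/
noncomputable def topDeriv (m : ℕ) (hm : 1 ≤ m) :
    sobolev m hm →ₗ[ℝ] Lp ℝ 2 (volume.restrict I01) where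
  toFun f := (W.memLp_top f.2).toLp (D m f)
  map_add' f g := by
    rw [← MemLp.toLp_add, MemLp.toLp_eq_toLp_iff]
    have := W.D_linear_ae hm f.2 g.2 1 1
    simp only [one_mul] at this
    exact this
  map_smul' c f := by
    rw [RingHom.id_apply, ← MemLp.toLp_const_smul, MemLp.toLp_eq_toLp_iff]
    have := W.D_linear_ae hm f.2 f.2 c 0
    simp only [zero_mul, add_zero] at this
    exact this

/-- The inclusion of `W m` into `L²`. -/
noncomputable def toL2 (m : ℕ) (hm : 1 ≤ m) :
    sobolev m hm →ₗ[ℝ] Lp ℝ 2 (volume.restrict I01) where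
  toFun f := (W.memLp_self f.2).toLp f
  map_add' _ _ := rfl
  map_smul' _ _ := rfl

end Basic

section L2

variable {f g : ℝ → ℝ}

lemma integral_zero_one (f : ℝ → ℝ) : ∫ x in (0 : ℝ)..1, f x = ∫ x in I01, f x := by
  rw [intervalIntegral.integral_of_le zero_le_one, integral_Icc_eq_integral_Ioc]

lemma inner_toLp (hf : MemLp f 2 (volume.restrict I01)) (hg : MemLp g 2 (volume.restrict I01)) :
    inner ℝ (hf.toLp f) (hg.toLp g) = inner₂ f g := by
  rw [L2.inner_def, inner₂, integral_zero_one]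
  refine integral_congr_ae ?_
  filter_upwards [hf.coeFn_toLp, hg.coeFn_toLp] with x hx hy
  rw [hx, hy, real_inner_eq_re_inner ℝ]
  simp [mul_comm]

lemma norm_toLp (hf : MemLp f 2 (volume.restrict I01)) : ‖hf.toLp f‖ = norm₂ f := by
  rw [norm₂, ← inner_toLp hf hf, real_inner_self_eq_norm_sq, Real.sqrt_sq (norm_nonneg _)]

lemma inner₂_self_nonneg (f : ℝ → ℝ) : 0 ≤ inner₂ f f :=
  intervalIntegral.integral_nonneg zero_le_one fun _ _ => mul_self_nonneg _

lemma norm₂_sq (f : ℝ → ℝ) : norm₂ f ^ 2 = inner₂ f f := Real.sq_sqrt (inner₂_self_nonneg f)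

lemma norm₂_nonneg (f : ℝ → ℝ) : 0 ≤ norm₂ f := Real.sqrt_nonneg _

lemma abs_inner₂_le (hf : MemLp f 2 (volume.restrict I01))
    (hg : MemLp g 2 (volume.restrict I01)) : |inner₂ f g| ≤ norm₂ f * norm₂ g := by
  rw [← inner_toLp hf hg, ← norm_toLp hf, ← norm_toLp hg]
  exact abs_real_inner_le_norm _ _

lemma integral_sq_eq (f : ℝ → ℝ) : ∫ x in (0 : ℝ)..1, f x ^ 2 = inner₂ f f := by
  simp only [inner₂, sq]

lemma inner₂_congr {f' g' : ℝ → ℝ} (hf : f =ᵐ[volume.restrict I01] f')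
    (hg : g =ᵐ[volume.restrict I01] g') : inner₂ f g = inner₂ f' g' := by
  rw [inner₂, inner₂, integral_zero_one, integral_zero_one]
  refine integral_congr_ae ?_
  filter_upwards [hf, hg] with x hx hy
  rw [hx, hy]

lemma intervalIntegrable_of_memLp_two (hf : MemLp f 2 (volume.restrict I01)) {a b : ℝ}
    (ha : a ∈ I01) (hb : b ∈ I01) : IntervalIntegrable f volume a b := by
  have : IntegrableOn f I01 := hf.integrable one_le_two
  exact (this.mono_set (uIcc_subset_I01 ha hb)).intervalIntegrable

/-- Cauchy–Schwarz against the indicator of a subinterval. -/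
lemma abs_integral_le (hf : MemLp f 2 (volume.restrict I01)) {a b : ℝ} (ha : a ∈ I01)
    (hb : b ∈ I01) : |∫ x in a..b, f x| ≤ √|b - a| * norm₂ f := by
  have hs : uIoc a b ⊆ I01 := uIoc_subset_I01 ha hb
  set i : ℝ → ℝ := (uIoc a b).indicator 1 with hi
  have hi2 : MemLp i 2 (volume.restrict I01) :=
    (memLp_const (1 : ℝ)).indicator measurableSet_uIoc
  have hset : ∀ g : ℝ → ℝ, ∫ x in (0 : ℝ)..1, i x * g x = ∫ x in uIoc a b, g x := fun g => by
    have : (fun x => i x * g x) = (uIoc a b).indicator g := by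
      ext x
      by_cases hx : x ∈ uIoc a b <;> simp [hi, hx]
    rw [integral_zero_one, this, setIntegral_indicator measurableSet_uIoc,
      inter_eq_self_of_subset_right hs]
  have h1 : |∫ x in a..b, f x| = |inner₂ i f| := by
    rw [inner₂, hset, intervalIntegral.abs_integral_eq_abs_integral_uIoc]
  have h2 : norm₂ i = √|b - a| := by
    rw [norm₂, inner₂, hset]
    congr 1
    have : ∫ x in uIoc a b, i x = ∫ x in uIoc a b, (1 : ℝ) :=
      setIntegral_congr_fun measurableSet_uIoc fun x hx => by simp [hi, hx]
    rw [this]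
    simp [measureReal_def, uIoc, Real.volume_Ioc, max_sub_min_eq_abs']
    exact abs_sub_comm _ _
  rw [h1, ← h2]
  exact abs_inner₂_le hi2 hf

end L2

/-! ### Taylor's formula and the Sobolev inequality -/

/-- Taylor's formula at `a` for the derivative of order `j = m - (i + 1)`, with the remainder
controlled by the `L²` norm of the top derivative. -/
lemma W.taylor_bound {m : ℕ} {f : ℝ → ℝ} (hf : f ∈ W m) {a : ℝ} (ha : a ∈ I01) :
    ∀ i j : ℕ, j + (i + 1) = m → ∀ x ∈ I01,
      |D j f x - ∑ k ∈ Finset.range (i + 1), D (j + k) f a * ((x - a) ^ k / k.factorial)| ≤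
        |x - a| ^ i * (√|x - a| * norm₂ (D m f))
  | 0, j, hj, x, hx => by
    have h1 : D j f x - D j f a = ∫ s in a..x, D m f s := by
      rw [← hj, W.integral_eq_sub hf (by lia) ha hx]
    simpa [h1] using abs_integral_le (W.memLp_top hf) ha hx
  | i + 1, j, hj, x, hx => by
    set q : ℝ → ℝ := fun s => D (j + 1) f s -
      ∑ k ∈ Finset.range (i + 1), D (j + 1 + k) f a * ((s - a) ^ k / k.factorial) with hq
    have hint : ∫ s in a..x, q s = D j f x -
        ∑ k ∈ Finset.range (i + 1 + 1), D (j + k) f a * ((x - a) ^ k / k.factorial) := by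
      have hc : ∀ k, IntervalIntegrable
          (fun s => D (j + 1 + k) f a * ((s - a) ^ k / k.factorial)) volume a x := fun k =>
        Continuous.intervalIntegrable (by fun_prop) _ _
      rw [hq, intervalIntegral.integral_sub
        (intervalIntegrable_of_memLp_two (W.memLp (j := j + 1) hf (by lia)) ha hx)
        (Continuous.intervalIntegrable (by fun_prop) _ _),
        intervalIntegral.integral_finsetSum fun k _ => hc k,
        W.integral_eq_sub hf (by lia) ha hx, Finset.sum_range_succ' _ (i + 1)]
      have hk : ∀ k, ∫ s in a..x, D (j + 1 + k) f a * ((s - a) ^ k / k.factorial) =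
          D (j + (k + 1)) f a * ((x - a) ^ (k + 1) / (k + 1).factorial) := fun k => by
        rw [intervalIntegral.integral_const_mul, intervalIntegral.integral_div,
          intervalIntegral.integral_comp_sub_right (fun s => s ^ k), integral_pow,
          Nat.factorial_succ, add_assoc, add_comm 1 k]
        have : (k.factorial : ℝ) ≠ 0 := by positivity
        have : (k : ℝ) + 1 ≠ 0 := by positivity
        push_cast
        field_simp
        simp
      simp only [hk, add_zero, pow_zero, Nat.factorial_zero, Nat.cast_one, div_one, mul_one]
      ring
    rw [← hint]
    have hbound : ∀ s ∈ uIoc a x, ‖q s‖ ≤ |x - a| ^ i * (√|x - a| * norm₂ (D m f)) := by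
      intro s hs
      have hsI := uIoc_subset_I01 ha hx hs
      refine (W.taylor_bound hf ha i (j + 1) (by lia) s hsI).trans ?_
      have hle : |s - a| ≤ |x - a| := abs_sub_left_of_mem_uIcc (uIoc_subset_uIcc hs)
      gcongr
      · exact mul_nonneg (Real.sqrt_nonneg _) (norm₂_nonneg _)
      · exact norm₂_nonneg _
    have := intervalIntegral.norm_integral_le_of_norm_le_const hbound
    rw [Real.norm_eq_abs] at this
    refine this.trans (le_of_eq ?_)
    ring

/-- This makes evaluation continuous on the right inverse of `f ↦ f^(m)` given by iterated
integration. -/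
lemma W.abs_le_of_vanishing_jet {m : ℕ} (hm : 1 ≤ m) {f : ℝ → ℝ} (hf : f ∈ W m)
    (h0 : ∀ j < m, D j f 0 = 0) {x : ℝ} (hx : x ∈ I01) : |f x| ≤ norm₂ (D m f) := by
  obtain ⟨i, rfl⟩ := Nat.exists_eq_add_of_le' hm
  have h := W.taylor_bound hf (a := 0) ⟨le_rfl, zero_le_one⟩ i 0 (by lia) x hx
  rw [Finset.sum_eq_zero fun k hk => by
    rw [zero_add, h0 k (Finset.mem_range.1 hk), zero_mul], sub_zero, sub_zero, D_zero,
    abs_of_nonneg hx.1] at h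
  refine h.trans ?_
  have h1 : x ^ i ≤ 1 := pow_le_one₀ hx.1 hx.2
  have h2 : √x ≤ 1 := Real.sqrt_le_one.2 hx.2
  calc x ^ i * (√x * norm₂ (D (i + 1) f)) ≤ 1 * (1 * norm₂ (D (i + 1) f)) := by
        gcongr
        · exact mul_nonneg (Real.sqrt_nonneg _) (norm₂_nonneg _)
        · exact norm₂_nonneg _
    _ = _ := by ring

/-- On polynomials of degree less than `m`, coefficients are controlled by the `L²([0,1])` norm. -/
lemma exists_coeff_bound (m : ℕ) : ∃ C : ℝ, 0 < C ∧ ∀ q : Fin m → ℝ, ∀ k,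
    q k ^ 2 ≤ C * ∫ u in (0 : ℝ)..1, (∑ i, q i * u ^ (i : ℕ)) ^ 2 := by
  let p : (Fin m → ℝ) → ℝ → ℝ := fun q u => ∑ i, q i * u ^ (i : ℕ)
  have hcont : ∀ q, Continuous (p q) := fun q => by fun_prop
  have hmem : ∀ q, MemLp (p q) 2 (volume.restrict I01) := fun q => (hcont q).continuousOn.memLp_two
  let T : (Fin m → ℝ) →ₗ[ℝ] Lp ℝ 2 (volume.restrict I01) :=
    { toFun := fun q => (hmem q).toLp (p q)
      map_add' := fun q r => by
        rw [← MemLp.toLp_add, MemLp.toLp_eq_toLp_iff]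
        refine ae_of_all _ fun u => ?_
        simp [p, add_mul, Finset.sum_add_distrib]
      map_smul' := fun c q => by
        rw [RingHom.id_apply, ← MemLp.toLp_const_smul, MemLp.toLp_eq_toLp_iff]
        refine ae_of_all _ fun u => ?_
        simp [p, Finset.mul_sum, mul_assoc] }
  have hTq : ∀ q, T q = (hmem q).toLp (p q) := fun q => rfl
  clear_value T
  have hT : ∀ q, ‖T q‖ ^ 2 = ∫ u in (0 : ℝ)..1, (∑ i, q i * u ^ (i : ℕ)) ^ 2 := fun q => by
    rw [hTq, norm_toLp, norm₂_sq, ← integral_sq_eq]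
  have hker : LinearMap.ker T = ⊥ := by
    refine (LinearMap.ker_eq_bot').2 fun q hq => ?_
    rw [hTq] at hq
    have hae : p q =ᵐ[volume.restrict I01] 0 :=
      (hmem q).coeFn_toLp.symm.trans (hq ▸ Lp.coeFn_zero ℝ 2 _)
    have hzero : EqOn (p q) 0 (Ioo (0 : ℝ) 1) :=
      Measure.eqOn_open_of_ae_eq (μ := volume)
        (ae_restrict_of_ae_restrict_of_subset Ioo_subset_Icc_self hae) isOpen_Ioo
        (hcont q).continuousOn continuousOn_const
    set r : Polynomial ℝ := ∑ i : Fin m, Polynomial.monomial (i : ℕ) (q i) with hr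
    have hr0 : r = 0 := by
      refine Polynomial.eq_zero_of_infinite_isRoot _
        ((Ioo_infinite zero_lt_one).mono fun u hu => ?_)
      have := hzero hu
      simpa [p, hr, Polynomial.IsRoot, Polynomial.eval_finsetSum] using this
    ext k
    have := congrArg (fun r => Polynomial.coeff r k) hr0
    simpa [hr, Polynomial.finsetSum_coeff, Polynomial.coeff_monomial, Fin.val_inj] using this
  obtain ⟨C, hC, hanti⟩ := T.exists_antilipschitzWith hker
  refine ⟨C ^ 2, by positivity, fun q k => ?_⟩
  rw [← hT]
  have h1 : ‖q‖ ≤ C * ‖T q‖ := by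
    have := hanti.le_mul_norm_sub q 0
    simpa using this
  have h2 : |q k| ≤ ‖q‖ := norm_le_pi_norm q k
  calc q k ^ 2 = |q k| ^ 2 := (sq_abs _).symm
    _ ≤ (C * ‖T q‖) ^ 2 := by gcongr; exact h2.trans h1
    _ = _ := by ring

lemma integral_comp_affine_le {f : ℝ → ℝ} (hf : ContinuousOn f I01) {a c : ℝ} (hc : c ≠ 0)
    (ha : a ∈ I01) (hac : a + c ∈ I01) :
    ∫ u in (0 : ℝ)..1, f (a + c * u) ^ 2 ≤ |c|⁻¹ * inner₂ f f := by
  have h1 := intervalIntegral.integral_comp_add_mul (fun x => f x ^ 2) hc a (a := 0) (b := 1)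
  rw [h1]
  simp only [mul_zero, add_zero, mul_one, smul_eq_mul]
  refine (le_abs_self _).trans ?_
  rw [abs_mul, abs_inv]
  refine mul_le_mul_of_nonneg_left ?_ (by positivity)
  rw [intervalIntegral.abs_integral_eq_abs_integral_uIoc,
    abs_of_nonneg (integral_nonneg fun x => sq_nonneg _), ← integral_sq_eq, integral_zero_one]
  exact setIntegral_mono_set ((hf.pow 2).integrableOn_compact isCompact_Icc)
    (ae_of_all _ fun x => sq_nonneg _) (uIoc_subset_I01 ha hac).eventuallyLE

/-- The Sobolev inequality at scale `h`: a derivative of order `k < m` at a point is controlled by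
the Taylor polynomial on an interval of length `h` ending at that point. -/
theorem exists_sobolev_bound (m : ℕ) (hm : 1 ≤ m) : ∃ C : ℝ, 0 < C ∧ ∀ h : ℝ, 0 < h → h ≤ 1 / 2 →
    ∀ f ∈ W m, ∀ k < m, ∀ a ∈ I01,
      D k f a ^ 2 * h ^ (2 * k) ≤ C / h * innerW m (h ^ (2 * m)) f f := by
  obtain ⟨C, hC, hcoef⟩ := exists_coeff_bound m
  refine ⟨2 * C * (m.factorial : ℝ) ^ 2, by positivity, fun h hh hh2 f hf k hk a ha => ?_⟩
  obtain ⟨i, rfl⟩ := Nat.exists_eq_add_of_le' hm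
  -- the interval of length `h` starts or ends at `a`, whichever keeps it inside `[0, 1]`
  obtain ⟨c, hc, hac⟩ : ∃ c : ℝ, |c| = h ∧ a + c ∈ I01 := by
    rcases le_total a (1 / 2) with h1 | h1
    · exact ⟨h, abs_of_pos hh, by linarith [ha.1], by linarith⟩
    · exact ⟨-h, by rw [abs_neg, abs_of_pos hh], by linarith, by linarith [ha.2]⟩
  have hc0 : c ≠ 0 := by rintro rfl; simp at hc; exact hh.ne hc
  have hmemI : ∀ u ∈ I01, a + c * u ∈ I01 := fun u hu => by
    have : a + c * u = (1 - u) * a + u * (a + c) := by ring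
    rw [this]
    exact convex_Icc (0 : ℝ) 1 ha hac (by linarith [hu.2]) hu.1 (by ring)
  -- Taylor coefficients of `u ↦ f (a + c * u)` at `0`
  set q : Fin (i + 1) → ℝ := fun k => D k f a * (c ^ (k : ℕ) / (k : ℕ).factorial) with hq
  set N := norm₂ (D (i + 1) f) with hN
  have hfc : ContinuousOn f I01 := D_zero f ▸ W.continuousOn hf (Nat.succ_pos i)
  have hfc' : ContinuousOn (fun u => f (a + c * u)) I01 :=
    hfc.comp (Continuous.continuousOn (by fun_prop)) hmemI
  have hpt : ∀ u ∈ I01, (∑ k, q k * u ^ (k : ℕ)) ^ 2 ≤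
      2 * f (a + c * u) ^ 2 + 2 * (h ^ (2 * i + 1) * N ^ 2) := by
    intro u hu
    have ht := W.taylor_bound hf ha i 0 (by lia) (a + c * u) (hmemI u hu)
    have hs : ∑ k, q k * u ^ (k : ℕ) = ∑ k ∈ Finset.range (i + 1),
        D (0 + k) f a * ((a + c * u - a) ^ k / k.factorial) := by
      rw [Finset.sum_range]
      refine Finset.sum_congr rfl fun k _ => ?_
      simp only [hq]
      rw [zero_add, add_sub_cancel_left, mul_pow]
      ring
    rw [← hs, D_zero, add_sub_cancel_left] at ht
    have hle : |c * u| ≤ h := by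
      rw [abs_mul, hc, abs_of_nonneg hu.1]
      exact mul_le_of_le_one_right hh.le hu.2
    have hr : (f (a + c * u) - ∑ k, q k * u ^ (k : ℕ)) ^ 2 ≤ h ^ (2 * i + 1) * N ^ 2 := by
      calc _ = |f (a + c * u) - ∑ k, q k * u ^ (k : ℕ)| ^ 2 := (sq_abs _).symm
        _ ≤ (h ^ i * (√h * N)) ^ 2 := by
            gcongr
            refine ht.trans ?_
            gcongr
            · exact mul_nonneg (Real.sqrt_nonneg _) (norm₂_nonneg _)
            · exact norm₂_nonneg _
        _ = _ := by
            rw [mul_pow, mul_pow, Real.sq_sqrt hh.le]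
            ring
    nlinarith [sq_nonneg (2 * f (a + c * u) - ∑ k, q k * u ^ (k : ℕ))]
  have hint : ∫ u in (0 : ℝ)..1, (∑ k, q k * u ^ (k : ℕ)) ^ 2 ≤
      2 * (h⁻¹ * inner₂ f f) + 2 * (h ^ (2 * i + 1) * N ^ 2) := by
    have hI : IntervalIntegrable (fun u => f (a + c * u) ^ 2) volume 0 1 :=
      (uIcc_zero_one ▸ hfc'.pow 2).intervalIntegrable
    calc _ ≤ ∫ u in (0 : ℝ)..1, (2 * f (a + c * u) ^ 2 + 2 * (h ^ (2 * i + 1) * N ^ 2)) := by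
          refine intervalIntegral.integral_mono_on zero_le_one
            (Continuous.intervalIntegrable (by fun_prop) _ _)
            ((hI.const_mul 2).add (by simp)) hpt
      _ = 2 * (∫ u in (0 : ℝ)..1, f (a + c * u) ^ 2) + 2 * (h ^ (2 * i + 1) * N ^ 2) := by
          rw [intervalIntegral.integral_add (hI.const_mul 2) (by simp),
            intervalIntegral.integral_const_mul]
          simp
      _ ≤ _ := by
          have := integral_comp_affine_le hfc hc0 ha hac
          rw [hc] at this
          linarith
  have hk1 := hcoef q ⟨k, hk⟩
  have hfac : (k.factorial : ℝ) ^ 2 ≤ ((i + 1).factorial : ℝ) ^ 2 := by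
    gcongr
  have hkey : D k f a ^ 2 * h ^ (2 * k) = q ⟨k, hk⟩ ^ 2 * (k.factorial : ℝ) ^ 2 := by
    have : (k.factorial : ℝ) ≠ 0 := by positivity
    simp only [hq]
    rw [← hc, pow_mul, sq_abs, ← pow_mul, mul_pow, div_pow]
    field_simp
    ring
  rw [hkey, innerW]
  have hN2 : N ^ 2 = inner₂ (D (i + 1) f) (D (i + 1) f) := norm₂_sq _
  have hbr : 0 ≤ h⁻¹ * inner₂ f f + h ^ (2 * i + 1) * N ^ 2 := by
    have := inner₂_self_nonneg f
    positivity
  calc q ⟨k, hk⟩ ^ 2 * (k.factorial : ℝ) ^ 2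
      ≤ (C * (2 * (h⁻¹ * inner₂ f f) + 2 * (h ^ (2 * i + 1) * N ^ 2))) *
        ((i + 1).factorial : ℝ) ^ 2 := by
        refine mul_le_mul (hk1.trans (mul_le_mul_of_nonneg_left hint hC.le)) hfac (by positivity) ?_
        exact mul_nonneg hC.le (by linarith)
    _ = _ := by
        rw [← hN2]
        field_simp
        ring

/-! ### Existence of smoothing splines -/

section Surjective

lemma D_congr {f g : ℝ → ℝ} (h : EqOn f g I01) (j : ℕ) : EqOn (D j f) (D j g) I01 :=
  iteratedDerivWithin_congr h

/-- If `F' = f` on `[0,1]` with `f` in `W m`, then `F` lies in `W (m + 1)`. -/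
lemma W.mem_succ {m : ℕ} {f F : ℝ → ℝ} (hf : f ∈ W m)
    (hF : ∀ x ∈ I01, HasDerivAt F (f x) x)
    (hFac : AbsolutelyContinuousOnInterval F 0 1) :
    F ∈ W (m + 1) ∧ ∀ j, EqOn (D (j + 1) F) (D j f) I01 := by
  have h1 : EqOn (D 1 F) f I01 := fun x hx => by
    rw [D_succ, D_zero]
    exact (hF x hx).hasDerivWithinAt.derivWithin (uniqueDiffOn_I01 x hx)
  have hD : ∀ j, EqOn (D (j + 1) F) (D j f) I01 := fun j => by
    rw [D_add_eq]
    exact D_congr h1 j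
  refine ⟨⟨fun j hj => ?_, fun j hj => ?_, ?_⟩, hD⟩
  · cases j with
    | zero => rw [D_zero]; exact fun x hx => (hF x hx).differentiableAt.differentiableWithinAt
    | succ j => exact (hf.1 j (by lia)).congr (hD j)
  · cases j with
    | zero => rwa [D_zero]
    | succ j => exact (hf.2.1 j (by lia)).congr (uIcc_zero_one ▸ (hD j).symm)
  · refine (memLp_congr_ae ?_).2 hf.2.2
    filter_upwards [ae_restrict_mem measurableSet_Icc] with x hx
    exact hD m hx

/-- Every square integrable function is the `m`-th derivative of an element of `W m` whose jet of
order `m - 1` at `0` vanishes: its `m`-fold iterated integral. -/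
theorem exists_topDeriv_eq {g : ℝ → ℝ} (hg : MemLp g 2 (volume.restrict I01)) :
    ∀ m : ℕ, ∃ f ∈ W (m + 1), (∀ j < m + 1, D j f 0 = 0) ∧ D (m + 1) f =ᵐ[volume.restrict I01] g
  | 0 => by
    have hi : IntervalIntegrable g volume 0 1 :=
      intervalIntegrable_of_memLp_two hg ⟨le_rfl, zero_le_one⟩ ⟨zero_le_one, le_rfl⟩
    set F : ℝ → ℝ := fun x => ∫ s in (0 : ℝ)..x, g s with hF
    have hac : AbsolutelyContinuousOnInterval F 0 1 :=
      hi.absolutelyContinuousOnInterval_intervalIntegral left_mem_uIcc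
    have hae : D (0 + 1) F =ᵐ[volume.restrict I01] g := by
      filter_upwards [ae_restrict_of_ae hi.ae_hasDerivAt_integral,
        ae_restrict_mem measurableSet_Icc] with x hx hxI
      rw [D_succ, D_zero]
      exact (hx (uIcc_zero_one ▸ hxI) 0 left_mem_uIcc).hasDerivWithinAt.derivWithin
        (uniqueDiffOn_I01 x hxI)
    refine ⟨F, ⟨fun j hj => by lia, fun j hj => ?_, (memLp_congr_ae hae).2 hg⟩, fun j hj => ?_, hae⟩
    · obtain rfl : j = 0 := by lia
      rwa [D_zero]
    · obtain rfl : j = 0 := by lia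
      rw [D_zero]
      exact intervalIntegral.integral_same
  | m + 1 => by
    obtain ⟨f, hf, hf0, hfg⟩ := exists_topDeriv_eq hg m
    have hfc : ContinuousOn f I01 := D_zero f ▸ W.continuousOn hf (Nat.succ_pos m)
    set f' : ℝ → ℝ := IccExtend zero_le_one (I01.domRestrict f) with hf'
    have hcont : Continuous f' := hfc.domRestrict.Icc_extend'
    have heq : EqOn f f' I01 := fun x hx =>
      (IccExtend_of_mem zero_le_one (I01.domRestrict f) hx).symm
    set F : ℝ → ℝ := fun x => ∫ s in (0 : ℝ)..x, f' s with hF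
    have hderiv : ∀ x ∈ I01, HasDerivAt F (f x) x := fun x hx =>
      heq hx ▸ (hcont.integral_hasStrictDerivAt 0 x).hasDerivAt
    have hac : AbsolutelyContinuousOnInterval F 0 1 :=
      (hcont.intervalIntegrable 0 1).absolutelyContinuousOnInterval_intervalIntegral left_mem_uIcc
    obtain ⟨hW, hD⟩ := W.mem_succ hf hderiv hac
    refine ⟨F, hW, fun j hj => ?_, ?_⟩
    · cases j with
      | zero =>
        rw [D_zero]
        exact intervalIntegral.integral_same
      | succ j => rw [hD j ⟨le_rfl, zero_le_one⟩, hf0 j (by lia)]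
    · refine EventuallyEq.trans ?_ hfg
      filter_upwards [ae_restrict_mem measurableSet_Icc] with x hx
      exact hD (m + 1) hx

/-- The elements of `W m` whose jet of order `m - 1` at `0` vanishes. -/
def vanishingJet (m : ℕ) (hm : 1 ≤ m) : Submodule ℝ (sobolev m hm) where
  carrier := {f | ∀ j < m, D j f 0 = 0}
  zero_mem' j _ := congrFun (D_zero_fun j) 0
  add_mem' {f g} hf hg j hj := by
    have := W.D_linear f.2 g.2 1 1 hj ⟨le_rfl, zero_le_one⟩
    simp only [one_mul, hf j hj, hg j hj, add_zero] at this
    exact this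
  smul_mem' c f hf j hj := by
    have := W.D_linear f.2 f.2 c 0 hj ⟨le_rfl, zero_le_one⟩
    simp only [hf j hj, zero_mul, mul_zero, add_zero] at this
    exact this

/-- Evaluation of an element of `W m` at finitely many points. -/
def evalAt (m : ℕ) (hm : 1 ≤ m) {n : ℕ} (t : Fin n → ℝ) : sobolev m hm →ₗ[ℝ] (Fin n → ℝ) where
  toFun f i := f.1 (t i)
  map_add' _ _ := rfl
  map_smul' _ _ := rfl

/-- A linear right inverse of `f ↦ f^(m)` along which point evaluations are continuous. -/
lemma exists_rightInverse_topDeriv (m : ℕ) (hm : 1 ≤ m) {n : ℕ} {t : Fin n → ℝ}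
    (ht : ∀ i, t i ∈ I01) :
    ∃ J : Lp ℝ 2 (volume.restrict I01) →ₗ[ℝ] sobolev m hm,
      (∀ g, topDeriv m hm (J g) = g) ∧ Continuous fun g => evalAt m hm t (J g) := by
  obtain ⟨k, rfl⟩ := Nat.exists_eq_add_of_le' hm
  obtain ⟨J, hJ⟩ := ((topDeriv (k + 1) hm).domRestrict (vanishingJet (k + 1) hm)
    ).exists_rightInverse_of_surjective (LinearMap.range_eq_top.2 fun g => by
      obtain ⟨f, hf, hf0, hfg⟩ := exists_topDeriv_eq (Lp.memLp g) k
      refine ⟨⟨⟨f, hf⟩, hf0⟩, ?_⟩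
      have : (W.memLp_top hf).toLp (D (k + 1) f) = (Lp.memLp g).toLp g :=
        (MemLp.toLp_eq_toLp_iff _ _).2 hfg
      rw [Lp.toLp_coeFn] at this
      exact this)
  have hJ' : ∀ g, topDeriv (k + 1) hm (J g) = g := fun g => LinearMap.congr_fun hJ g
  refine ⟨(vanishingJet (k + 1) hm).subtype ∘ₗ J, hJ', ?_⟩
  refine AddMonoidHomClass.continuous_of_bound
    (evalAt (k + 1) hm t ∘ₗ (vanishingJet (k + 1) hm).subtype ∘ₗ J) 1 fun g => ?_
  rw [one_mul, pi_norm_le_iff_of_nonneg (norm_nonneg _)]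
  intro i
  have h := W.abs_le_of_vanishing_jet hm (J g).1.2 (J g).2 (ht i)
  rw [← norm_toLp (W.memLp_top (J g).1.2)] at h
  change |_| ≤ ‖topDeriv (k + 1) hm (J g)‖ at h
  rw [hJ'] at h
  exact h

end Surjective

/-- A coercive function of finitely many linear functionals plus a quadratic penalty attains its
minimum. No coercivity on the null space of the penalty is required: modulo the kernel `N` of the
functionals, whose image under `B` is closed, the problem is finite-dimensional. -/
theorem exists_forall_penalized_le {X H : Type*} [AddCommGroup X] [Module ℝ X]
    [NormedAddCommGroup H] [InnerProductSpace ℝ H] [CompleteSpace H] {n : ℕ}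
    (T : X →ₗ[ℝ] (Fin n → ℝ)) (B : X →ₗ[ℝ] H) (J : H →ₗ[ℝ] X) (hBJ : ∀ g, B (J g) = g)
    (hTJ : Continuous fun g => T (J g)) {Φ : (Fin n → ℝ) → ℝ} (hΦ : Continuous Φ)
    (hΦ' : Tendsto Φ (cocompact _) atTop) {lam : ℝ} (hlam : 0 ≤ lam) :
    ∃ f, ∀ g, Φ (T f) + lam * ‖B f‖ ^ 2 ≤ Φ (T g) + lam * ‖B g‖ ^ 2 := by
  set S : Submodule ℝ H := (LinearMap.ker T).map B with hS
  have hSclosed : IsClosed (S : Set H) := by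
    have : (S : Set H) = (fun g => T (J g)) ⁻¹' ((LinearMap.ker B).map T) := by
      ext g
      simp only [hS, Submodule.map_coe, mem_image, SetLike.mem_coe, LinearMap.mem_ker, mem_preimage]
      constructor
      · rintro ⟨f, hf, rfl⟩
        exact ⟨J (B f) - f, by rw [map_sub, hBJ, sub_self], by rw [map_sub, hf, sub_zero]⟩
      · rintro ⟨p, hp, hpg⟩
        exact ⟨J g - p, by rw [map_sub, hpg, sub_self], by rw [map_sub, hBJ, hp, sub_zero]⟩
    rw [this]
    exact ((LinearMap.ker B).map T).closed_of_finiteDimensional.preimage hTJ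
  have : CompleteSpace S := hSclosed.completeSpace_coe
  -- `‖A f‖` is the least penalty norm among the elements with the same values as `f`
  set A : X →ₗ[ℝ] H := Sᗮ.starProjection.toLinearMap ∘ₗ B with hA
  have hAle : ∀ f, ‖A f‖ ≤ ‖B f‖ := fun f => Sᗮ.norm_starProjection_apply_le (B f)
  have hAker : ∀ f, T f = 0 → A f = 0 := fun f hf => by
    refine (Submodule.starProjection_apply_eq_zero_iff (K := Sᗮ)).2 ?_
    exact S.le_orthogonal_orthogonal ⟨f, hf, rfl⟩
  have hlift : ∀ f, ∃ f', T f' = T f ∧ B f' = A f := fun f => by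
    obtain ⟨k, hk, hkf⟩ : S.starProjection (B f) ∈ S := S.starProjection_apply_mem _
    refine ⟨f - k, by rw [map_sub, LinearMap.mem_ker.1 hk, sub_zero], ?_⟩
    rw [map_sub, hkf]
    exact (S.starProjection_orthogonal_val (B f)).symm
  obtain ⟨σ, hσ⟩ := T.rangeRestrict.exists_rightInverse_of_surjective T.range_rangeRestrict
  have hσ' : ∀ v : LinearMap.range T, T (σ v) = v := fun v =>
    congrArg Subtype.val (LinearMap.congr_fun hσ v)
  have hcontA : Continuous (A ∘ₗ σ) := LinearMap.continuous_of_finiteDimensional _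
  have hcoer : Tendsto (fun v : LinearMap.range T => Φ v + lam * ‖A (σ v)‖ ^ 2)
      (cocompact _) atTop := by
    have hcl : Topology.IsClosedEmbedding ((↑) : LinearMap.range T → (Fin n → ℝ)) :=
      (LinearMap.range T).closed_of_finiteDimensional.isClosedEmbedding_subtypeVal
    exact tendsto_atTop_mono (fun v => le_add_of_nonneg_right (by positivity))
      (hΦ'.comp hcl.tendsto_cocompact)
  have hcont : Continuous fun v : LinearMap.range T => Φ v + lam * ‖A (σ v)‖ ^ 2 :=
    (hΦ.comp continuous_subtype_val).add (continuous_const.mul (hcontA.norm.pow 2))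
  obtain ⟨v, hv⟩ := hcont.exists_forall_le hcoer
  obtain ⟨f, hTf, hBf⟩ := hlift (σ v)
  refine ⟨f, fun g => ?_⟩
  have h1 := hv ⟨T g, LinearMap.mem_range_self T g⟩
  have h2 : A (σ ⟨T g, LinearMap.mem_range_self T g⟩) = A g := by
    rw [← sub_eq_zero, ← map_sub]
    exact hAker _ (by rw [map_sub, hσ', sub_self])
  simp only [h2] at h1
  rw [hTf, hσ', hBf]
  refine h1.trans ?_
  have := hAle g
  gcongr

section Loss

variable {ρ ψ : ℝ → ℝ}

/-- A convex loss with subgradients of both signs grows at least linearly in both directions. -/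
lemma tendsto_empiricalLoss_cocompact (hψ : IsSubgradient ρ ψ) {a b : ℝ} (ha : 0 < ψ a)
    (hb : ψ b < 0) {n : ℕ} (hn : 1 ≤ n) (y : Fin n → ℝ) :
    Tendsto (fun v : Fin n → ℝ => 1 / (n : ℝ) * ∑ i, ρ (y i - v i)) (cocompact _) atTop := by
  set α := min (ψ a) (-ψ b) with hα
  have hα0 : 0 < α := lt_min ha (neg_pos.2 hb)
  obtain ⟨β, hβ⟩ : ∃ β, ∀ x, α * |x| - β ≤ ρ x := by
    refine ⟨|ρ a| + |ρ b| + |ψ a * a| + |ψ b * b|, fun x => ?_⟩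
    have h1 := hψ a x
    have h2 := hψ b x
    have l1 := neg_abs_le (ρ a)
    have l2 := neg_abs_le (ρ b)
    have l3 := le_abs_self (ψ a * a)
    have l4 := le_abs_self (ψ b * b)
    have p1 := abs_nonneg (ρ a)
    have p2 := abs_nonneg (ρ b)
    have p3 := abs_nonneg (ψ a * a)
    have p4 := abs_nonneg (ψ b * b)
    have m1 : α ≤ ψ a := min_le_left _ _
    have m2 : α ≤ -ψ b := min_le_right _ _
    rcases abs_cases x with ⟨hx, hx0⟩ | ⟨hx, hx0⟩
    · rw [hx]
      nlinarith [mul_le_mul_of_nonneg_right m1 hx0]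
    · rw [hx]
      nlinarith [mul_le_mul_of_nonneg_right m2 (neg_nonneg.2 hx0.le)]
  have hn' : (0 : ℝ) < n := by exact_mod_cast hn
  have hlow : ∀ v : Fin n → ℝ, α / n * ‖v‖ - (α / n * ‖y‖ + β) ≤
      1 / (n : ℝ) * ∑ i, ρ (y i - v i) := fun v => by
    have h1 : ∑ i, (α * |y i - v i| - β) ≤ ∑ i, ρ (y i - v i) :=
      Finset.sum_le_sum fun i _ => hβ _
    have h2 : ‖y - v‖ ≤ ∑ i, |y i - v i| := by
      rw [pi_norm_le_iff_of_nonneg (Finset.sum_nonneg fun i _ => abs_nonneg _)]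
      exact fun i => Finset.single_le_sum (f := fun i => |y i - v i|)
        (fun i _ => abs_nonneg _) (Finset.mem_univ i)
    have h3 : ‖v‖ - ‖y‖ ≤ ‖y - v‖ := by
      rw [norm_sub_rev]
      exact norm_sub_norm_le v y
    rw [Finset.sum_sub_distrib, ← Finset.mul_sum, Finset.sum_const, Finset.card_univ,
      Fintype.card_fin, nsmul_eq_mul] at h1
    have h4 : α * (‖v‖ - ‖y‖) ≤ α * ∑ i, |y i - v i| :=
      mul_le_mul_of_nonneg_left (h3.trans h2) hα0.le
    calc _ = 1 / (n : ℝ) * (α * (‖v‖ - ‖y‖) - n * β) := by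
          field_simp
          ring
      _ ≤ _ := by gcongr; linarith
  refine tendsto_atTop_mono hlow (tendsto_atTop_add_const_right _ _ ?_)
  exact tendsto_norm_cocompact_atTop.const_mul_atTop (div_pos hα0 hn')

/-- Existence of M-type smoothing splines for a coercive convex loss. -/
theorem exists_isMTypeSpline (hρ : Continuous ρ) (hψ : IsSubgradient ρ ψ) {a b : ℝ} (ha : 0 < ψ a)
    (hb : ψ b < 0) {m : ℕ} (hm : 1 ≤ m) {n : ℕ} (hn : 1 ≤ n) {lam : ℝ} (hlam : 0 ≤ lam)
    {t : Fin n → ℝ} (ht : ∀ i, t i ∈ I01) (y : Fin n → ℝ) :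
    ∃ f, IsMTypeSpline ρ m lam t y f := by
  obtain ⟨J, hJ, hJ'⟩ := exists_rightInverse_topDeriv m hm ht
  have hc : Continuous fun v : Fin n → ℝ => 1 / (n : ℝ) * ∑ i, ρ (y i - v i) := by fun_prop
  obtain ⟨f, hf⟩ := exists_forall_penalized_le (evalAt m hm t) (topDeriv m hm) J hJ hJ' hc
    (tendsto_empiricalLoss_cocompact hψ ha hb hn y) hlam
  have hobj : ∀ g : sobolev m hm, 1 / (n : ℝ) * ∑ i, ρ (y i - evalAt m hm t g i) +
      lam * ‖topDeriv m hm g‖ ^ 2 = objective ρ m lam t y g := fun g => by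
    rw [objective, integral_sq_eq, ← norm₂_sq, ← norm_toLp (W.memLp_top g.2)]
    rfl
  refine ⟨f, f.2, fun g hg => ?_⟩
  have := hf ⟨g, hg⟩
  rwa [hobj, hobj] at this

end Loss

/-! ### Representers, design points and the expected loss -/

section Representer

/-- A linear functional that is bounded with respect to the seminorm `‖ι ·‖` pulled back from a
Hilbert space is represented by a vector of that Hilbert space. -/
lemma exists_representer {X H : Type*} [AddCommGroup X] [Module ℝ X] [NormedAddCommGroup H]
    [InnerProductSpace ℝ H] [CompleteSpace H] (ι : X →ₗ[ℝ] H) (l : X →ₗ[ℝ] ℝ) {κ : ℝ}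
    (hκ : 0 ≤ κ) (hl : ∀ f, |l f| ≤ κ * ‖ι f‖) :
    ∃ a : H, ‖a‖ ≤ κ ∧ ∀ f, inner ℝ a (ι f) = l f := by
  obtain ⟨σ, hσ⟩ := ι.rangeRestrict.exists_rightInverse_of_surjective ι.range_rangeRestrict
  have hσ' : ∀ v : LinearMap.range ι, ι (σ v) = v := fun v =>
    congrArg Subtype.val (LinearMap.congr_fun hσ v)
  let φ : StrongDual ℝ (LinearMap.range ι) := (l ∘ₗ σ).mkContinuous κ fun v => by
    have := hl (σ v)
    rwa [hσ'] at this
  have hφ : ∀ v, φ v = l (σ v) := fun _ => rfl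
  obtain ⟨Φ, hΦ, hnorm⟩ := exists_extension_norm_eq (LinearMap.range ι) φ
  refine ⟨(InnerProductSpace.toDual ℝ H).symm Φ, ?_, fun f => ?_⟩
  · rw [LinearIsometryEquiv.norm_map, hnorm]
    exact LinearMap.mkContinuous_norm_le _ hκ _
  · rw [InnerProductSpace.toDual_symm_apply]
    have h1 := hΦ ⟨ι f, LinearMap.mem_range_self ι f⟩
    simp only at h1
    rw [h1, hφ, ← sub_eq_zero, ← map_sub]
    have h2 := hl (σ ⟨ι f, LinearMap.mem_range_self ι f⟩ - f)
    rw [map_sub ι, hσ', sub_self, norm_zero, mul_zero] at h2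
    exact abs_nonpos_iff.1 h2

/-- The isometric copy of `W m`, with the norm `normW m lam`, in `L² × L²`. -/
noncomputable def embed (m : ℕ) (hm : 1 ≤ m) (lam : ℝ) :
    sobolev m hm →ₗ[ℝ]
      WithLp 2 (Lp ℝ 2 (volume.restrict I01) × Lp ℝ 2 (volume.restrict I01)) :=
  (WithLp.linearEquiv 2 ℝ _).symm.toLinearMap ∘ₗ
    (toL2 m hm).prod (√lam • topDeriv m hm)

lemma norm_topDeriv_sq {m : ℕ} {hm : 1 ≤ m} (f : sobolev m hm) :
    ‖topDeriv m hm f‖ ^ 2 = inner₂ (D m f) (D m f) := by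
  rw [← norm₂_sq, ← norm_toLp (W.memLp_top f.2)]
  rfl

lemma norm_embed_sq {m : ℕ} {hm : 1 ≤ m} {lam : ℝ} (hlam : 0 ≤ lam) (f : sobolev m hm) :
    ‖embed m hm lam f‖ ^ 2 = innerW m lam f f := by
  have h1 : ‖toL2 m hm f‖ ^ 2 = inner₂ f f := by
    rw [← norm₂_sq, ← norm_toLp (W.memLp_self f.2)]
    rfl
  rw [WithLp.prod_norm_sq_eq_of_L2, innerW, ← h1, ← norm_topDeriv_sq]
  change ‖toL2 m hm f‖ ^ 2 + ‖√lam • topDeriv m hm f‖ ^ 2 = _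
  rw [norm_smul, mul_pow, Real.norm_eq_abs, sq_abs, Real.sq_sqrt hlam]

lemma objective_eq {ρ : ℝ → ℝ} {m : ℕ} {hm : 1 ≤ m} {lam : ℝ} {n : ℕ} {t y : Fin n → ℝ}
    (f : sobolev m hm) : objective ρ m lam t y f =
      1 / (n : ℝ) * ∑ i, ρ (y i - f.1 (t i)) + lam * ‖topDeriv m hm f‖ ^ 2 := by
  rw [objective, integral_sq_eq, norm_topDeriv_sq]

end Representer

section Design

lemma innerW_self_nonneg {m : ℕ} {lam : ℝ} (hlam : 0 ≤ lam) (f : ℝ → ℝ) :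
    0 ≤ innerW m lam f f :=
  add_nonneg (inner₂_self_nonneg f) (mul_nonneg hlam (inner₂_self_nonneg _))

lemma W.sq_mem {m : ℕ} (hm : 1 ≤ m) {f : ℝ → ℝ} (hf : f ∈ W m) :
    (fun x => f x ^ 2) ∈ W 1 ∧
      D 1 (fun x => f x ^ 2) =ᵐ[volume.restrict I01] fun x => 2 * f x * D 1 f x := by
  have hac : AbsolutelyContinuousOnInterval f 0 1 := D_zero f ▸ W.absolutelyContinuous hf hm
  have hac2 : AbsolutelyContinuousOnInterval (fun x => f x ^ 2) 0 1 := by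
    simp only [sq]
    exact hac.fun_mul hac
  have hae : D 1 (fun x => f x ^ 2) =ᵐ[volume.restrict I01] fun x => 2 * f x * D 1 f x := by
    filter_upwards [hac.ae_hasDerivAt, ae_restrict_mem measurableSet_Icc] with x hx hxI
    rw [D_succ, D_zero, D_succ, D_zero]
    simpa using (hx.fun_pow 2).hasDerivWithinAt.derivWithin (uniqueDiffOn_I01 x hxI)
  refine ⟨⟨fun j hj => by lia, fun j hj => ?_, (memLp_congr_ae hae).2 ?_⟩, hae⟩
  · obtain rfl : j = 0 := by lia
    rwa [D_zero]
  · obtain ⟨K, hK⟩ := hac.exists_bound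
    have h1 := W.memLp hf hm
    refine h1.of_le_mul (c := 2 * K)
      (((W.memLp_self hf).aestronglyMeasurable.const_mul 2).mul h1.aestronglyMeasurable) ?_
    filter_upwards [ae_restrict_mem measurableSet_Icc] with x hx
    rw [norm_mul, norm_mul, Real.norm_ofNat]
    have := hK x (uIcc_zero_one ▸ hx)
    gcongr

lemma inner₂_mul_le {f g : ℝ → ℝ} {b : ℝ} (hg : MemLp g 2 (volume.restrict I01))
    (hb : ∀ x ∈ I01, f x ^ 2 ≤ b) :
    inner₂ (fun x => 2 * f x * g x) (fun x => 2 * f x * g x) ≤ 4 * b * inner₂ g g := by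
  rw [inner₂, inner₂, integral_zero_one, integral_zero_one, ← integral_const_mul]
  have hi : IntegrableOn (fun x => g x * g x) I01 := by
    simp only [← sq]
    exact hg.integrable_sq
  refine integral_mono_of_nonneg (ae_of_all _ fun x => mul_self_nonneg _) (hi.const_mul _) ?_
  filter_upwards [ae_restrict_mem measurableSet_Icc] with x hx
  nlinarith [mul_le_mul_of_nonneg_right (hb x hx) (mul_self_nonneg (g x))]

/-- The empirical and the integrated squares of a function of `W m` agree up to a small fraction of
`normW m lam f ^ 2`, where `lam = h ^ (2 * m)`. -/
lemma abs_empirical_sq_sub_le {m : ℕ} (hm : 1 ≤ m) {C h c : ℝ} (hC : 0 < C) (hh : 0 < h)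
    (hh2 : h ≤ 1 / 2)
    (hsob : ∀ f ∈ W m, ∀ k < m, ∀ a ∈ I01,
      D k f a ^ 2 * h ^ (2 * k) ≤ C / h * innerW m (h ^ (2 * m)) f f)
    {n : ℕ} (hn : 2 ≤ n) {t : Fin n → ℝ}
    (ht : ∀ f ∈ W 1, |(1 / (n : ℝ)) * (∑ i, f (t i)) - ∫ x in (0 : ℝ)..1, f x| ≤
      c / n * norm₂ (D 1 f)) {f : ℝ → ℝ} (hf : f ∈ W m) :
    |(1 / (n : ℝ)) * (∑ i, f (t i) ^ 2) - inner₂ f f| ≤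
      |c| * (2 * √C) / (n * h ^ 2) * innerW m (h ^ (2 * m)) f f := by
  have hn0 : (0 : ℝ) < n := by exact_mod_cast (by lia : 0 < n)
  set E := innerW m (h ^ (2 * m)) f f with hE
  have hE0 : 0 ≤ E := innerW_self_nonneg (by positivity) f
  obtain ⟨hmem, hae⟩ := W.sq_mem hm hf
  have hkey : norm₂ (D 1 fun x => f x ^ 2) ≤ 2 * √C / h ^ 2 * E := by
    refine Real.sqrt_le_iff.2 ⟨by positivity, ?_⟩
    rw [inner₂_congr hae hae, mul_pow, div_pow, mul_pow, Real.sq_sqrt hC.le]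
    have hmid : inner₂ (fun x => 2 * f x * D 1 f x) (fun x => 2 * f x * D 1 f x) ≤
        4 * C / h ^ 3 * E ^ 2 := by
      -- for `m = 1` the sup norm falls on `f`, otherwise on `f'`
      rcases hm.eq_or_lt with rfl | hm2
      · have hb : ∀ x ∈ I01, f x ^ 2 ≤ C / h * E := fun x hx => by
          simpa [D_zero] using hsob f hf 0 (by lia) x hx
        refine (inner₂_mul_le (W.memLp_top hf) hb).trans ?_
        have h1 : h ^ 2 * inner₂ (D 1 f) (D 1 f) ≤ E := by
          have := inner₂_self_nonneg f
          simp only [hE, innerW, mul_one]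
          linarith
        calc 4 * (C / h * E) * inner₂ (D 1 f) (D 1 f)
            = 4 * C / h ^ 3 * E * (h ^ 2 * inner₂ (D 1 f) (D 1 f)) := by field_simp
          _ ≤ 4 * C / h ^ 3 * E * E := by gcongr
          _ = _ := by ring
      · have hb : ∀ x ∈ I01, D 1 f x ^ 2 ≤ C / h ^ 3 * E := fun x hx => by
          have := hsob f hf 1 hm2 x hx
          rw [mul_one, ← le_div_iff₀ (by positivity)] at this
          refine this.trans (le_of_eq ?_)
          rw [← hE]
          field_simp
        have hsw : (fun x => 2 * f x * D 1 f x) = fun x => 2 * D 1 f x * f x := by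
          ext x; ring
        rw [hsw]
        refine (inner₂_mul_le (W.memLp_self hf) hb).trans ?_
        have h1 : inner₂ f f ≤ E := by
          have := inner₂_self_nonneg (D m f)
          simp only [hE, innerW]
          have : 0 ≤ h ^ (2 * m) * inner₂ (D m f) (D m f) := by positivity
          linarith
        calc 4 * (C / h ^ 3 * E) * inner₂ f f ≤ 4 * (C / h ^ 3 * E) * E := by gcongr
          _ = _ := by ring
    refine hmid.trans ?_
    have h4 : (h ^ 2) ^ 2 ≤ h ^ 3 := by
      have : (0 : ℝ) ≤ h ^ 3 := by positivity
      nlinarith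
    have : (2 : ℝ) ^ 2 = 4 := by norm_num
    rw [this]
    gcongr
  rw [← integral_sq_eq]
  calc _ ≤ c / n * norm₂ (D 1 fun x => f x ^ 2) := ht _ hmem
    _ ≤ |c| / n * norm₂ (D 1 fun x => f x ^ 2) := by
        gcongr
        · exact norm₂_nonneg _
        · exact le_abs_self c
    _ ≤ |c| / n * (2 * √C / h ^ 2 * E) := by gcongr
    _ = _ := by field_simp

end Design

section Score

variable {ρ ψ : ℝ → ℝ} {μ : Measure ℝ} {ξ δ : ℝ}

lemma IsSubgradient.monotone (hψ : IsSubgradient ρ ψ) : Monotone ψ := by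
  intro x y hxy
  rcases hxy.eq_or_lt with rfl | hlt
  · exact le_rfl
  · have h1 := hψ x y
    have h2 := hψ y x
    nlinarith

/-- Increment of the loss when the residual `e` is perturbed by `-u`. -/
def increment (ρ : ℝ → ℝ) (u e : ℝ) : ℝ := ρ (e - u) - ρ e

lemma isLipschitzLoss_increment (hρ : Continuous ρ) (hψ : IsSubgradient ρ ψ)
    (hL2 : ∀ s, |s| ≤ δ → MemLp (fun e => ψ (e + s)) 2 μ) (hδ : 0 < δ) :
    IsLipschitzLoss μ (increment ρ) (fun e => |ψ (e + -δ)| + |ψ (e + δ)|) δ where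
  measurable u := by unfold increment; fun_prop
  zero e := by simp [increment]
  memLp := (hL2 (-δ) (by rw [abs_neg, abs_of_pos hδ])).abs.add (hL2 δ (abs_of_pos hδ).le).abs
  lipschitz e u v hu _ := by
    have h1 := hψ (e - u) (e - v)
    have h2 : |ψ (e - u)| ≤ |ψ (e + -δ)| + |ψ (e + δ)| := by
      have m1 : ψ (e + -δ) ≤ ψ (e - u) := hψ.monotone (by linarith [(abs_le.1 hu).2])
      have m2 : ψ (e - u) ≤ ψ (e + δ) := hψ.monotone (by linarith [(abs_le.1 hu).1])
      have a1 := neg_abs_le (ψ (e + -δ))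
      have a2 := le_abs_self (ψ (e + δ))
      have a3 := abs_nonneg (ψ (e + -δ))
      have a4 := abs_nonneg (ψ (e + δ))
      exact abs_le.2 ⟨by linarith, by linarith⟩
    calc increment ρ u e - increment ρ v e = ρ (e - u) - ρ (e - v) := by
          unfold increment; ring
      _ ≤ -(ψ (e - u) * (u - v)) := by
          rw [sub_sub_sub_cancel_left] at h1
          linarith
      _ ≤ |ψ (e - u)| * |u - v| := by rw [← abs_mul]; exact neg_le_abs _
      _ ≤ _ := by gcongr

/-- Quadratic growth of the expected loss. Two subgradient inequalities, at the residual and at half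
of the perturbation, replace the integral representation of the loss by its score. -/
lemma le_integral_increment [IsProbabilityMeasure μ] (hρ : Continuous ρ) (hψ : IsSubgradient ρ ψ)
    (hL2 : ∀ s, |s| ≤ δ → MemLp (fun e => ψ (e + s)) 2 μ) (hδ : 0 < δ)
    (h0 : ∫ e, ψ e ∂μ = 0)
    (hlin : ∀ s, |s| ≤ δ → |(∫ e, ψ (e + s) ∂μ) - ξ * s| ≤ ξ / 2 * |s|) {u : ℝ} (hu : |u| ≤ δ) :
    ξ / 8 * u ^ 2 ≤ ∫ e, increment ρ u e ∂μ := by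
  have hs : |-u / 2| ≤ δ := by
    rw [abs_div, abs_neg, abs_two]
    linarith [abs_nonneg u]
  set s := -u / 2 with hsdef
  have i0 : Integrable ψ μ := by
    simpa using (hL2 0 (by simpa using hδ.le)).integrable one_le_two
  have is : Integrable (fun e => ψ (e + s)) μ := (hL2 s hs).integrable one_le_two
  have hle : ∫ e, (s * ψ (e + s) + s * ψ e) ∂μ ≤ ∫ e, increment ρ u e ∂μ := by
    refine integral_mono ((is.const_mul s).add (i0.const_mul s))
      ((isLipschitzLoss_increment hρ hψ hL2 hδ).integrable hu) fun e => ?_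
    have h1 := hψ (e + s) (e - u)
    have h2 := hψ e (e + s)
    have e1 : e - u - (e + s) = s := by rw [hsdef]; ring
    rw [e1] at h1
    rw [add_sub_cancel_left] at h2
    simp only [increment]
    linarith
  rw [integral_add (is.const_mul s) (i0.const_mul s), integral_const_mul, integral_const_mul, h0,
    mul_zero, add_zero] at hle
  refine le_trans ?_ hle
  have h3 := hlin s hs
  have h4 : |s * ((∫ e, ψ (e + s) ∂μ) - ξ * s)| ≤ ξ / 2 * s ^ 2 := by
    rw [abs_mul]
    calc _ ≤ |s| * (ξ / 2 * |s|) := by gcongr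
      _ = ξ / 2 * |s| ^ 2 := by ring
      _ = _ := by rw [sq_abs]
  have h5 := (abs_le.1 h4).1
  have h6 : u ^ 2 = 4 * s ^ 2 := by rw [hsdef]; ring
  rw [h6]
  nlinarith

/-- The linearized mean of the score has both signs near zero, hence so has the score. -/
lemma exists_pos_neg (hδ : 0 < δ) (hξ : 0 < ξ)
    (hlin : ∀ s, |s| ≤ δ → |(∫ e, ψ (e + s) ∂μ) - ξ * s| ≤ ξ / 2 * |s|) :
    (∃ a, 0 < ψ a) ∧ ∃ b, ψ b < 0 := by
  constructor
  · by_contra! h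
    have h1 := hlin δ (abs_of_pos hδ).le
    have h2 : ∫ e, ψ (e + δ) ∂μ ≤ 0 := integral_nonpos fun e => h _
    rw [abs_of_pos hδ] at h1
    nlinarith [(abs_le.1 h1).1, mul_pos hξ hδ]
  · by_contra! h
    have h1 := hlin (-δ) (by rw [abs_neg, abs_of_pos hδ])
    have h2 : 0 ≤ ∫ e, ψ (e + -δ) ∂μ := integral_nonneg fun e => h _
    rw [abs_neg, abs_of_pos hδ] at h1
    nlinarith [(abs_le.1 h1).2, mul_pos hξ hδ]

/-- The local form of the assumptions on the score that the argument uses, in terms of the law `μ`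
of the errors. -/
lemma exists_radius (hψ : IsSubgradient ρ ψ) (hξ : 0 < ξ)
    (hA2 : Tendsto (fun s : ℝ => ∫⁻ e, ENNReal.ofReal ((ψ (e + s) - ψ e) ^ 2) ∂μ) (𝓝 0) (𝓝 0))
    (hsq : Integrable (fun e => ψ e ^ 2) μ)
    (hlin : (fun s : ℝ => (∫ e, ψ (e + s) ∂μ) - ξ * s) =o[𝓝 0] (fun s : ℝ => |s|)) :
    ∃ δ > 0, (∀ s, |s| ≤ δ → MemLp (fun e => ψ (e + s)) 2 μ) ∧
      ∀ s, |s| ≤ δ → |(∫ e, ψ (e + s) ∂μ) - ξ * s| ≤ ξ / 2 * |s| := by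
  have hmeas : Measurable ψ := hψ.monotone.measurable
  have h1 := hA2.eventually (gt_mem_nhds (zero_lt_one (α := ENNReal)))
  have h2 := hlin.bound (half_pos hξ)
  obtain ⟨η, hη, hball⟩ := Metric.eventually_nhds_iff.1 (h1.and h2)
  refine ⟨η / 2, half_pos hη, fun s hs => ?_, fun s hs => ?_⟩
  all_goals
    have hd : dist s 0 < η := by rw [Real.dist_eq, sub_zero]; linarith
  · have hψ2 : MemLp ψ 2 μ := (memLp_two_iff_integrable_sq hmeas.aestronglyMeasurable).2 hsq
    have hm2 : Measurable fun e => ψ (e + s) - ψ e :=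
      (hmeas.comp (measurable_add_const s)).sub hmeas
    have hdiff : MemLp (fun e => ψ (e + s) - ψ e) 2 μ := by
      refine (memLp_two_iff_integrable_sq hm2.aestronglyMeasurable).2
        ⟨(hm2.pow_const 2).aestronglyMeasurable, ?_⟩
      rw [hasFiniteIntegral_iff_ofReal (ae_of_all _ fun e => sq_nonneg _)]
      exact (hball hd).1.trans ENNReal.one_lt_top
    refine (memLp_congr_ae (ae_of_all _ fun e => ?_)).1 (hdiff.add hψ2)
    exact sub_add_cancel _ _
  · simpa using (hball hd).2

end Score

/-! ### Localization and the exceptional set -/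

section Localization

variable {ρ : ℝ → ℝ} {m : ℕ} {hm : 1 ≤ m} {lam : ℝ} {n : ℕ} {t y : Fin n → ℝ}

lemma convexOn_objective (hρ : ConvexOn ℝ univ ρ) (hlam : 0 ≤ lam) :
    ConvexOn ℝ univ fun f : sobolev m hm => objective ρ m lam t y f := by
  refine ⟨convex_univ, fun f _ g _ a b ha hb hab => ?_⟩
  simp only [objective_eq, smul_eq_mul]
  have h1 : ∑ i, ρ (y i - (a • f + b • g : sobolev m hm).1 (t i)) ≤
      ∑ i, (a * ρ (y i - f.1 (t i)) + b * ρ (y i - g.1 (t i))) := by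
    refine Finset.sum_le_sum fun i _ => ?_
    have e : y i - (a • f + b • g : sobolev m hm).1 (t i) =
        a * (y i - f.1 (t i)) + b * (y i - g.1 (t i)) := by
      change y i - (a * f.1 (t i) + b * g.1 (t i)) = _
      have : y i = (a + b) * y i := by rw [hab, one_mul]
      linear_combination this
    rw [e]
    exact hρ.2 (mem_univ _) (mem_univ _) ha hb hab
  have h2 : ‖topDeriv m hm (a • f + b • g)‖ ^ 2 ≤
      a * ‖topDeriv m hm f‖ ^ 2 + b * ‖topDeriv m hm g‖ ^ 2 := by
    rw [map_add, map_smul, map_smul]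
    exact ((convexOn_univ_norm (E := Lp ℝ 2 (volume.restrict I01))).pow
      (fun _ _ => norm_nonneg _) 2).2 (mem_univ _) (mem_univ _) ha hb hab
  rw [Finset.sum_add_distrib, ← Finset.mul_sum, ← Finset.mul_sum] at h1
  have h3 := mul_le_mul_of_nonneg_left h1 (by positivity : (0 : ℝ) ≤ 1 / n)
  have h4 := mul_le_mul_of_nonneg_left h2 hlam
  linarith

/-- By convexity, a point outside a ball around `f` at which the objective does not exceed its value
at `f` yields such a point on the boundary of the ball. -/
lemma exists_on_sphere (hρ : ConvexOn ℝ univ ρ) (hlam : 0 ≤ lam) {f fhat : sobolev m hm} {R : ℝ}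
    (hR : 0 ≤ R) (hobj : objective ρ m lam t y fhat ≤ objective ρ m lam t y f)
    (hout : R < ‖embed m hm lam (fhat - f)‖) :
    ∃ g : sobolev m hm, ‖embed m hm lam g‖ = R ∧
      objective ρ m lam t y (f + g : sobolev m hm) ≤ objective ρ m lam t y f := by
  set r := ‖embed m hm lam (fhat - f)‖ with hr
  have hr0 : 0 < r := hR.trans_lt hout
  have hs : R / r ≤ 1 := (div_le_one hr0).2 hout.le
  refine ⟨(R / r) • (fhat - f), ?_, ?_⟩
  · rw [map_smul, norm_smul, ← hr, Real.norm_of_nonneg (by positivity),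
      div_mul_cancel₀ _ hr0.ne']
  · have h := (convexOn_objective (hm := hm) (t := t) (y := y) hρ hlam).2 (mem_univ f)
      (mem_univ fhat) (sub_nonneg.2 hs) (by positivity : 0 ≤ R / r) (by ring)
    have e : (1 - R / r) • f + (R / r) • fhat = f + (R / r) • (fhat - f) := by module
    rw [e] at h
    refine h.trans ?_
    simp only [smul_eq_mul]
    have : 0 ≤ R / r := by positivity
    nlinarith

end Localization

/-- A deviation inequality for near-minimizers at a fixed sample size: outside a set of samples of
small probability, every `fhat` that does at least as well as `f₀` is within `R` of `f₀`. -/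
theorem exists_exceptional_set {ρ : ℝ → ℝ} (hρ : ConvexOn ℝ univ ρ) {μ : Measure ℝ}
    [IsProbabilityMeasure μ] {Λ : ℝ → ℝ} {δ ξ : ℝ} (hξ : 0 < ξ)
    (hU : IsLipschitzLoss μ (increment ρ) Λ δ)
    (hgrowth : ∀ u, |u| ≤ δ → ξ / 8 * u ^ 2 ≤ ∫ e, increment ρ u e ∂μ)
    {m : ℕ} (hm : 1 ≤ m) {C h : ℝ} (hC : 0 < C) (hh : 0 < h)
    (hsob : ∀ f ∈ W m, ∀ k < m, ∀ a ∈ I01,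
      D k f a ^ 2 * h ^ (2 * k) ≤ C / h * innerW m (h ^ (2 * m)) f f)
    {n : ℕ} (hn : 1 ≤ n) {t : Fin n → ℝ} (ht : ∀ i, t i ∈ I01)
    (hdesign : ∀ f ∈ W m, |(1 / (n : ℝ)) * (∑ i, f (t i) ^ 2) - inner₂ f f| ≤
      1 / 2 * innerW m (h ^ (2 * m)) f f)
    {f₀ : ℝ → ℝ} (hf₀ : f₀ ∈ W m) {R M : ℝ} (hR : 0 < R) (hM : 0 < M)
    (hsup : C / h * R ^ 2 ≤ δ ^ 2) (hδ : 0 ≤ δ)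
    (hbias : 8 * (√(h ^ (2 * m)) * norm₂ (D m f₀)) ≤ min (ξ / 8) 1 * R)
    (hrate : M / (n * h) ≤ R ^ 2) :
    ∃ E : Set (Fin n → ℝ), MeasurableSet E ∧
      (∀ e : Fin n → ℝ, ∀ fhat ∈ W m,
        objective ρ m (h ^ (2 * m)) t (fun i => f₀ (t i) + e i) fhat ≤
          objective ρ m (h ^ (2 * m)) t (fun i => f₀ (t i) + e i) f₀ →
        R ^ 2 < innerW m (h ^ (2 * m)) (fhat - f₀) (fhat - f₀) → e ∈ E) ∧
      (Measure.pi fun _ : Fin n => μ) E ≤ ENNReal.ofReal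
        (8 * (2 * C * (∫ e, Λ e ^ 2 ∂μ) + 1 / 2) / (min (ξ / 8) 1 * √M)) := by
  set lam := h ^ (2 * m) with hlam
  have hlam0 : 0 ≤ lam := by positivity
  set c₀ := min (ξ / 8) 1 with hc₀
  have hc₀pos : 0 < c₀ := lt_min (by positivity) one_pos
  have hn0 : (0 : ℝ) < n := by exact_mod_cast hn
  set ι := embed m hm lam with hι
  have hpt : ∀ (i : Fin n) (f : sobolev m hm), |f.1 (t i)| ≤ √(C / h) * ‖ι f‖ := fun i f => by
    have := hsob f f.2 0 hm (t i) (ht i)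
    rw [D_zero, mul_zero, pow_zero, mul_one, ← norm_embed_sq (hm := hm) hlam0] at this
    rw [← Real.sqrt_sq_eq_abs, ← Real.sqrt_sq (norm_nonneg (ι f)), ← Real.sqrt_mul (by positivity)]
    exact Real.sqrt_le_sqrt this
  choose a ha ha' using fun i : Fin n => exists_representer ι
    (LinearMap.proj i ∘ₗ evalAt m hm t) (Real.sqrt_nonneg _) (hpt i)
  have ha'' : ∀ i (f : sobolev m hm), inner ℝ (a i) (ι f) = f.1 (t i) := ha'
  set S : Set (WithLp 2 (Lp ℝ 2 (volume.restrict I01) × Lp ℝ 2 (volume.restrict I01))) :=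
    ι '' {g | ‖ι g‖ ≤ R} with hS
  have hsmall : ∀ g : sobolev m hm, ‖ι g‖ ≤ R → ∀ i, |g.1 (t i)| ≤ δ := fun g hg i => by
    refine abs_le_of_sq_le_sq ?_ hδ
    calc g.1 (t i) ^ 2 = |g.1 (t i)| ^ 2 := (sq_abs _).symm
      _ ≤ (√(C / h) * R) ^ 2 := by
          gcongr
          exact (hpt i g).trans (by gcongr)
      _ = C / h * R ^ 2 := by rw [mul_pow, Real.sq_sqrt (by positivity)]
      _ ≤ δ ^ 2 := hsup
  -- `τ = R * q` balances the two terms of the bound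
  set q := √(h / n) with hq
  have hq0 : 0 < q := Real.sqrt_pos.2 (by positivity)
  have hq2 : q ^ 2 = h / n := Real.sq_sqrt (by positivity)
  obtain ⟨E, hEm, hE, hEμ⟩ := hU.exists_measurableSet (S := S) (B := R) (K := C / h) (τ := R * q)
    (x := n * (c₀ * R ^ 2 / 8)) ⟨0, by simp [hR.le], map_zero _⟩ (by positivity) (by positivity)
    (by rintro _ ⟨g, hg, rfl⟩; exact hg) a
    (fun i => by
      calc ‖a i‖ ^ 2 ≤ √(C / h) ^ 2 := by gcongr; exact ha i
        _ = C / h := Real.sq_sqrt (by positivity))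
    (by rintro _ ⟨g, hg, rfl⟩ i; rw [ha'']; exact hsmall g hg i)
  refine ⟨E, hEm, fun e fhat hfhat hobj hout => ?_, hEμ.trans (ENNReal.ofReal_le_ofReal ?_)⟩
  · obtain ⟨g, hgR, hg⟩ := exists_on_sphere (f := (⟨f₀, hf₀⟩ : sobolev m hm))
      (fhat := ⟨fhat, hfhat⟩) (R := R) hρ hlam0 hR.le hobj (by
        refine lt_of_pow_lt_pow_left₀ 2 (norm_nonneg _) ?_
        rw [norm_embed_sq hlam0]
        exact hout)
    refine hE e (ι g) ⟨g, hgR.le, rfl⟩ ?_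
    simp only [ha'']
    set B := topDeriv m hm with hB
    set b₀ := B ⟨f₀, hf₀⟩ with hb₀
    have hb₀n : ‖b₀‖ = norm₂ (D m f₀) := norm_toLp (W.memLp_top hf₀)
    have hg2 : ‖ι g‖ ^ 2 = inner₂ g g + lam * ‖B g‖ ^ 2 := by
      rw [hι, norm_embed_sq hlam0, innerW, norm_topDeriv_sq]
    rw [hgR] at hg2
    -- the objective difference, with the penalty expanded around `f₀`
    have hexp : 1 / (n : ℝ) * ∑ i, increment ρ (g.1 (t i)) (e i) +
        lam * (2 * inner ℝ b₀ (B g) + ‖B g‖ ^ 2) ≤ 0 := by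
      rw [objective_eq, objective_eq, map_add, norm_add_sq_real] at hg
      have e1 : ∀ i, f₀ (t i) + e i - (⟨f₀, hf₀⟩ + g : sobolev m hm).1 (t i) =
          e i - g.1 (t i) := fun i => by
        change f₀ (t i) + e i - (f₀ (t i) + g.1 (t i)) = _
        ring
      simp only [e1, add_sub_cancel_left] at hg
      simp only [increment, Finset.sum_sub_distrib]
      linarith
    have hcross : |inner ℝ b₀ (B g)| ≤ norm₂ (D m f₀) * ‖B g‖ := hb₀n ▸ abs_real_inner_le_norm _ _
    have hBg : √lam * ‖B g‖ ≤ R := by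
      refine le_of_sq_le_sq ?_ hR.le
      rw [mul_pow, Real.sq_sqrt hlam0]
      linarith [inner₂_self_nonneg (g : ℝ → ℝ)]
    have hcross' : -(c₀ * R ^ 2 / 4) ≤ lam * (2 * inner ℝ b₀ (B g)) := by
      have h1 : lam * |inner ℝ b₀ (B g)| ≤ c₀ * R ^ 2 / 8 := by
        calc lam * |inner ℝ b₀ (B g)| ≤ lam * (norm₂ (D m f₀) * ‖B g‖) := by gcongr
          _ = (√lam * norm₂ (D m f₀)) * (√lam * ‖B g‖) := by
              nth_rewrite 1 [← Real.mul_self_sqrt hlam0]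
              ring
          _ ≤ (c₀ * R / 8) * R := by
              have := norm₂_nonneg (D m f₀)
              gcongr
              linarith
          _ = _ := by ring
      have h2 := mul_le_mul_of_nonneg_left (neg_abs_le (inner ℝ b₀ (B g))) hlam0
      linarith
    have hmean : ξ / 8 * ∑ i, g.1 (t i) ^ 2 ≤ ∑ i, ∫ s, increment ρ (g.1 (t i)) s ∂μ := by
      rw [Finset.mul_sum]
      exact Finset.sum_le_sum fun i _ => hgrowth _ (hsmall g hgR.le i)
    have hdes := (abs_le.1 (hdesign g g.2)).1
    rw [← norm_embed_sq (hm := hm) hlam0, ← hι, hgR] at hdes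
    -- the expected loss and the penalty together control `‖g‖ ^ 2 = R ^ 2`
    have hcurv : c₀ * (R ^ 2 / 2) ≤
        1 / (n : ℝ) * (∑ i, ∫ s, increment ρ (g.1 (t i)) s ∂μ) + lam * ‖B g‖ ^ 2 := by
      have h1 : c₀ * (1 / (n : ℝ) * ∑ i, g.1 (t i) ^ 2) ≤
          1 / (n : ℝ) * (∑ i, ∫ s, increment ρ (g.1 (t i)) s ∂μ) := by
        calc _ ≤ ξ / 8 * (1 / (n : ℝ) * ∑ i, g.1 (t i) ^ 2) := by
              have : 0 ≤ 1 / (n : ℝ) * ∑ i, g.1 (t i) ^ 2 := by positivity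
              gcongr
              exact min_le_left _ _
          _ = 1 / (n : ℝ) * (ξ / 8 * ∑ i, g.1 (t i) ^ 2) := by ring
          _ ≤ _ := by gcongr
      have h2 : c₀ * (lam * ‖B g‖ ^ 2) ≤ lam * ‖B g‖ ^ 2 :=
        mul_le_of_le_one_left (by positivity) (min_le_right _ _)
      nlinarith
    have hdev : c₀ * R ^ 2 / 4 ≤
        1 / (n : ℝ) * deviation μ (increment ρ) (fun i => g.1 (t i)) e := by
      rw [deviation, Finset.sum_sub_distrib, mul_sub]
      linarith
    rw [one_div, ← div_eq_inv_mul, le_div_iff₀ hn0] at hdev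
    refine lt_of_lt_of_le ?_ hdev
    have : 0 < c₀ * R ^ 2 * n := by positivity
    linarith
  · set cΛ := ∫ e, Λ e ^ 2 ∂μ with hcΛ
    have hcΛ0 : 0 ≤ cΛ := integral_nonneg fun e => sq_nonneg _
    have hnq : h = n * q ^ 2 := by rw [hq2]; field_simp
    have hkey : √M ≤ R * (n * q) := by
      refine Real.sqrt_le_iff.2 ⟨by positivity, ?_⟩
      rw [div_le_iff₀ (by positivity), hnq] at hrate
      calc M ≤ R ^ 2 * (n * (n * q ^ 2)) := hrate
        _ = _ := by ring
    have heq : (R * q / 2 * (n * (4 * (C / h) * cΛ)) + R ^ 2 / (2 * (R * q))) /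
        (n * (c₀ * R ^ 2 / 8)) = 8 * (2 * C * cΛ + 1 / 2) / (c₀ * (R * (n * q))) := by
      rw [hnq]
      field_simp
      ring
    rw [heq]
    gcongr

/-! ### Passage to the limit -/

/-- The law of the first `n` errors is a product measure. -/
lemma measurePreserving_errors {Ω : Type*} [MeasurableSpace Ω] {P : Measure Ω}
    [IsProbabilityMeasure P] {ε : ℕ → Ω → ℝ} (hmeas : ∀ i, Measurable (ε i))
    (hindep : iIndepFun ε P) (hident : ∀ i, IdentDistrib (ε i) (ε 0) P P) (n : ℕ) :
    MeasurePreserving (fun ω (i : Fin n) => ε i ω) P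
      (Measure.pi fun _ : Fin n => P.map (ε 0)) := by
  refine ⟨measurable_pi_lambda _ fun i => hmeas i, ?_⟩
  have h : iIndepFun (fun i : Fin n => ε i) P := hindep.precomp Fin.val_injective
  rw [h.map_fun_eq_pi_map fun i : Fin n => (hmeas i).aemeasurable]
  exact congrArg Measure.pi (funext fun i => (hident i).map_eq)

/-- The bandwidth `h = lam ^ (1 / (2 * m))` tends to zero, with `n * h ^ 2 = (n ^ m * lam) ^ (1 /
m)` tending to infinity. -/
lemma tendsto_bandwidth {m : ℕ} (hm : 1 ≤ m) {lam : ℕ → ℝ} (hpos : ∀ n, 1 ≤ n → 0 < lam n)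
    (hzero : Tendsto lam atTop (𝓝 0))
    (hinfty : Tendsto (fun n : ℕ => (n : ℝ) ^ m * lam n) atTop atTop) :
    Tendsto (fun n => lam n ^ (1 / (2 * (m : ℝ)))) atTop (𝓝 0) ∧
      Tendsto (fun n : ℕ => (n : ℝ) * (lam n ^ (1 / (2 * (m : ℝ)))) ^ 2) atTop atTop ∧
      ∀ n, 1 ≤ n → (lam n ^ (1 / (2 * (m : ℝ)))) ^ (2 * m) = lam n := by
  have hm0 : (0 : ℝ) < m := by exact_mod_cast hm
  have hp : (0 : ℝ) < 1 / (2 * (m : ℝ)) := by positivity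
  refine ⟨?_, ?_, fun n hn => ?_⟩
  · have := hzero.rpow_const (p := 1 / (2 * (m : ℝ))) (Or.inr hp.le)
    rwa [Real.zero_rpow hp.ne'] at this
  · have h1 := (tendsto_rpow_atTop (y := 1 / (m : ℝ)) (by positivity)).comp hinfty
    refine h1.congr' ?_
    filter_upwards [eventually_ge_atTop 1] with n hn
    have hl := (hpos n hn).le
    simp only [Function.comp_apply]
    rw [Real.mul_rpow (by positivity) hl, ← Real.rpow_natCast, ← Real.rpow_mul (Nat.cast_nonneg n),
      mul_one_div_cancel hm0.ne', Real.rpow_one, ← Real.rpow_natCast, ← Real.rpow_mul hl]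
    congr 2
    field_simp
    norm_num
  · rw [← Real.rpow_natCast, ← Real.rpow_mul (hpos n hn).le]
    push_cast
    rw [one_div_mul_cancel (by positivity), Real.rpow_one]

end MSpline

theorem theorem2
    {Ω : Type*} [MeasurableSpace Ω] (P : Measure Ω) [IsProbabilityMeasure P]
    (m : ℕ) (hm : 1 ≤ m)
    -- the loss function and a choice of its subgradient
    (ρ ψ : ℝ → ℝ) (hρ : ConvexOn ℝ Set.univ ρ) (hψ : MSpline.IsSubgradient ρ ψ)
    -- independent and identically distributed errors
    (ε : ℕ → Ω → ℝ) (hε_meas : ∀ i, Measurable (ε i)) (hε_indep : iIndepFun ε P)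
    (hε_ident : ∀ i, IdentDistrib (ε i) (ε 0) P P)
    -- mean-square continuity at zero
    (hA2 : Tendsto (fun s : ℝ => ∫⁻ ω, ENNReal.ofReal ((ψ (ε 0 ω + s) - ψ (ε 0 ω)) ^ 2) ∂P)
      (𝓝 0) (𝓝 0))
    -- moments of the score and linearization of its expectation
    (hA3_sq : Integrable (fun ω => ψ (ε 0 ω) ^ 2) P)
    (hA3_mean : ∫ ω, ψ (ε 0 ω) ∂P = 0)
    (ξ : ℝ) (hξ : 0 < ξ)
    (hA3_lin : (fun s : ℝ => (∫ ω, ψ (ε 0 ω + s) ∂P) - ξ * s) =o[𝓝 0] (fun s : ℝ => |s|))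
    -- design points
    (t : (n : ℕ) → Fin n → ℝ) (ht : ∀ n i, t n i ∈ Set.Icc (0 : ℝ) 1)
    (hA4 : MSpline.QuasiUniform t)
    -- smoothing parameters
    (lam : ℕ → ℝ) (hlam_pos : ∀ n, 1 ≤ n → 0 < lam n) (hlam_zero : Tendsto lam atTop (𝓝 0))
    (hlam_infty : Tendsto (fun n : ℕ => (n : ℝ) ^ m * lam n) atTop atTop)
    -- the true regression function
    (f₀ : ℝ → ℝ) (hf₀ : f₀ ∈ MSpline.W m) :
    ∃ fhat : (n : ℕ) → (Fin n → ℝ) → ℝ → ℝ,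
      (∀ n, 1 ≤ n → ∀ y : Fin n → ℝ, MSpline.IsMTypeSpline ρ m (lam n) (t n) y (fhat n y)) ∧
      MSpline.IsBigOP P
        (fun n ω =>
          MSpline.normW m (lam n) (fhat n (fun i => f₀ (t n i) + ε i ω) - f₀) ^ 2)
        (fun n => lam n + ((n : ℝ) * lam n ^ (1 / (2 * (m : ℝ))))⁻¹) := by
  open MSpline in
  have hρc : Continuous ρ := hρ.locallyLipschitz.continuous
  have hψm : Measurable ψ := hψ.monotone.measurable
  have hε0 := hε_meas 0
  set μ : Measure ℝ := P.map (ε 0) with hμ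
  have : IsProbabilityMeasure μ := Measure.isProbabilityMeasure_map hε0.aemeasurable
  have hψs : ∀ s, Measurable fun e => ψ (e + s) := fun s => hψm.comp (measurable_add_const s)
  have hint : ∀ s, ∫ e, ψ (e + s) ∂μ = ∫ ω, ψ (ε 0 ω + s) ∂P := fun s =>
    integral_map hε0.aemeasurable (hψs s).aestronglyMeasurable
  have hmean : ∫ e, ψ e ∂μ = 0 :=
    (integral_map hε0.aemeasurable hψm.aestronglyMeasurable).trans hA3_mean
  obtain ⟨δ, hδ, hL2, hlin⟩ := exists_radius (μ := μ) hψ hξ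
    (hA2.congr fun s => (lintegral_map
      (((hψs s).sub hψm).pow_const 2).ennreal_ofReal hε0).symm)
    ((integrable_map_measure (hψm.pow_const 2).aestronglyMeasurable hε0.aemeasurable).2 hA3_sq)
    (by simpa only [hint] using hA3_lin)
  obtain ⟨⟨a, ha⟩, b, hb⟩ := exists_pos_neg hδ hξ hlin
  have hU := isLipschitzLoss_increment hρc hψ hL2 hδ
  have hgrowth := fun u => le_integral_increment (u := u) hρc hψ hL2 hδ hmean hlin
  have hex : ∀ n, ∀ y : Fin n → ℝ, ∃ f, 1 ≤ n → IsMTypeSpline ρ m (lam n) (t n) y f := fun n y => by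
    by_cases hn : 1 ≤ n
    · obtain ⟨f, hf⟩ := exists_isMTypeSpline hρc hψ ha hb hm hn (hlam_pos n hn).le (ht n) y
      exact ⟨f, fun _ => hf⟩
    · exact ⟨0, fun h => absurd h hn⟩
  choose fhat hfhat using hex
  refine ⟨fhat, fun n hn y => hfhat n y hn, fun η hη => ?_⟩
  obtain ⟨C, hC, hsob⟩ := exists_sobolev_bound m hm
  obtain ⟨c, hc⟩ := hA4
  obtain ⟨hh0, hnh, hpow⟩ := tendsto_bandwidth hm hlam_pos hlam_zero hlam_infty
  set h : ℕ → ℝ := fun n => lam n ^ (1 / (2 * (m : ℝ))) with hh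
  set c₀ := min (ξ / 8) 1 with hc₀
  have hc₀pos : 0 < c₀ := lt_min (by positivity) one_pos
  set A := 8 * (2 * C * (∫ e, (|ψ (e + -δ)| + |ψ (e + δ)|) ^ 2 ∂μ) + 1 / 2) with hA
  have hA0 : 0 < A := by
    have : 0 ≤ ∫ e, (|ψ (e + -δ)| + |ψ (e + δ)|) ^ 2 ∂μ := integral_nonneg fun e => sq_nonneg _
    positivity
  -- the first entry makes the exceptional probability at most `η`, the second absorbs the bias
  set k := max (A / (c₀ * η)) (8 * norm₂ (D m f₀) / c₀) with hk
  have hk0 : 0 < k := lt_max_of_lt_left (by positivity)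
  have hkM : √(k ^ 2) = k := Real.sqrt_sq hk0.le
  refine ⟨k ^ 2, ?_⟩
  have hinv : Tendsto (fun n : ℕ => ((n : ℝ) * h n ^ 2)⁻¹) atTop (𝓝 0) := hnh.inv_tendsto_atTop
  have ev1 : ∀ᶠ n in atTop, h n < 1 / 2 := hh0.eventually (gt_mem_nhds (by norm_num))
  have ev2 : ∀ᶠ n : ℕ in atTop, |c| * (2 * √C) * ((n : ℝ) * h n ^ 2)⁻¹ < 1 / 2 := by
    have := hinv.const_mul (|c| * (2 * √C))
    rw [mul_zero] at this
    exact this.eventually (gt_mem_nhds (by norm_num))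
  have ev3 : ∀ᶠ n : ℕ in atTop, C * k ^ 2 * (h n + ((n : ℝ) * h n ^ 2)⁻¹) < δ ^ 2 := by
    have := (hh0.add hinv).const_mul (C * k ^ 2)
    rw [add_zero, mul_zero] at this
    exact this.eventually (gt_mem_nhds (by positivity))
  filter_upwards [ev1, ev2, ev3, eventually_ge_atTop 2] with n h1 h2 h3 hn2
  have hn1 : 1 ≤ n := by lia
  have hn0 : (0 : ℝ) < n := by exact_mod_cast hn1
  have hlam := hlam_pos n hn1
  have hhn : 0 < h n := Real.rpow_pos_of_pos hlam _
  have hpn : h n ^ (2 * m) = lam n := hpow n hn1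
  set r := lam n + ((n : ℝ) * h n)⁻¹ with hr
  have hr0 : 0 < r := by positivity
  set R := k * √r with hR
  have hR0 : 0 < R := mul_pos hk0 (Real.sqrt_pos.2 hr0)
  have hR2 : R ^ 2 = k ^ 2 * r := by rw [hR, mul_pow, Real.sq_sqrt hr0.le]
  have hlamh : lam n ≤ h n * h n := by
    rw [← hpn, pow_mul, ← sq]
    exact pow_le_of_le_one (sq_nonneg _) (pow_le_one₀ hhn.le (by linarith)) (by lia)
  obtain ⟨E, hEm, hE, hEμ⟩ := exists_exceptional_set hρ hξ hU (fun u => hgrowth u) hm hC hhn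
    (hsob (h n) hhn h1.le) hn1 (ht n) (fun f hf => by
      refine (abs_empirical_sq_sub_le hm hC hhn h1.le (hsob (h n) hhn h1.le) hn2 (hc n hn2)
        hf).trans ?_
      have := innerW_self_nonneg (m := m) (lam := h n ^ (2 * m)) (by positivity) f
      refine mul_le_mul_of_nonneg_right ?_ this
      rw [div_eq_mul_inv]
      exact h2.le) hf₀ hR0 (M := k ^ 2) (by positivity)
    (by
      rw [hR2]
      refine le_trans ?_ h3.le
      have e : C / h n * (k ^ 2 * r) = C * k ^ 2 * (lam n / h n + ((n : ℝ) * h n ^ 2)⁻¹) := by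
        rw [hr]
        field_simp
      rw [e]
      gcongr
      rwa [div_le_iff₀ hhn]) hδ.le
    (by
      rw [hpn]
      have l1 : √(lam n) ≤ √r := Real.sqrt_le_sqrt (le_add_of_nonneg_right (by positivity))
      have l2 : 8 * norm₂ (D m f₀) ≤ c₀ * k := by
        rw [mul_comm c₀, ← div_le_iff₀ hc₀pos]
        exact le_max_right _ _
      calc 8 * (√(lam n) * norm₂ (D m f₀)) = √(lam n) * (8 * norm₂ (D m f₀)) := by ring
        _ ≤ √r * (c₀ * k) := by
            have := norm₂_nonneg (D m f₀)
            gcongr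
        _ = c₀ * R := by rw [hR]; ring)
    (by
      rw [hR2, div_eq_mul_inv]
      gcongr
      exact le_add_of_nonneg_left hlam.le)
  rw [hpn] at hE
  have hsub : {ω | k ^ 2 * |r| <
      |normW m (lam n) (fhat n (fun i => f₀ (t n i) + ε i ω) - f₀) ^ 2|} ⊆
      (fun ω (i : Fin n) => ε i ω) ⁻¹' E := by
    intro ω hω
    have hspl := hfhat n (fun i => f₀ (t n i) + ε i ω) hn1
    refine hE _ _ hspl.1 (hspl.2 f₀ hf₀) ?_
    have hω' : k ^ 2 * |r| <
      |normW m (lam n) (fhat n (fun i => f₀ (t n i) + ε i ω) - f₀) ^ 2| := hω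
    rw [abs_of_pos hr0, abs_of_nonneg (sq_nonneg _), normW,
      Real.sq_sqrt (innerW_self_nonneg hlam.le _)] at hω'
    rwa [hR2]
  have hfin : A / (c₀ * √(k ^ 2)) ≤ η := by
    have l3 : A / (c₀ * η) ≤ k := le_max_left _ _
    rw [hkM, div_le_iff₀ (by positivity)]
    rw [div_le_iff₀ (by positivity)] at l3
    linarith
  calc _ ≤ P ((fun ω (i : Fin n) => ε i ω) ⁻¹' E) := measure_mono hsub
    _ = (Measure.pi fun _ : Fin n => μ) E :=
        (measurePreserving_errors hε_meas hε_indep hε_ident n).measure_preimage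
          hEm.nullMeasurableSet
    _ ≤ ENNReal.ofReal (A / (c₀ * √(k ^ 2))) := hEμ
    _ ≤ ENNReal.ofReal η := ENNReal.ofReal_le_ofReal hfin
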